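/- Let $k$ be a field of arbitrary characteristic. For a $k$-algebra $R$ (associative, unital) let $HH^n(R)=HH^n(R,R)$ denote the Hochschild cohomology of $R$ over $k$, that is, the cohomology of the complex of $k$-multilinear maps $R^n\to R$ with the Hochschild coboundary, and let the Hochschild dimension of $R$ be the supremum in $\mathbb{N}\cup\{\infty\}$ of all $n$ such that $HH^n(R,M)\neq 0$ for some $R$-bimodule $M$ (over $k$). Let $Q$ be the round-trip quiver, with two vertices $e,f$ and two arrows $e\to f$ and $f\to e$, and let $kQ/(Q_{\ge 2})$ be the quotient of its path algebra by the two-sided ideal generated by the paths of length at least $2$. Let $\widetilde Q$ be the quiver with three vertices and exactly one arrow, which joins two distinct vertices (so the third vertex is isolated), and let $k\widetilde Q$ be its path algebra. For algebras $A$, $B$ a linear map $\tau:B\otimes A\to A\otimes B$ is a twisting map if $\tau(b\otimes 1)=1\otimes b$ and $\tau(1\otimes a)=a\otimes 1$ for all $a\in A$, $b\in B$, $\tau\circ(B\otimes\mu_A)=(\mu_A\otimes B)\circ(A\otimes\tau)\circ(\tau\otimes A)$ and $\tau\circ(\mu_B\otimes A)=(A\otimes\mu_B)\circ(\tau\otimes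 B)\circ(B\otimes\tau)$, where $\mu_A,\mu_B$ are the multiplications; the twisted tensor product $A\otimes_\tau B$ is then the vector space $A\otimes B$ with the multiplication $(\mu_A\otimes\mu_B)\circ(A\otimes\tau\otimes B)$ and the unit $1\otimes 1$. Let $R$ be one of the algebras $k^4$, $\mathcal M_2(k)$, $kQ/(Q_{\ge 2})$, $k\widetilde Q$, or let $R=A\otimes_\tau B$ with algebras $A\cong B\cong k^2$ and a twisting map $\tau$. Then, as $k$-vector spaces: (I) if $R\cong k^4$, then $HH^0(R)\cong k^4$ and $HH^n(R)=0$ for all $n\ge 1$; (IIa) if $R\cong\mathcal M_2(k)$, then $HH^0(R)\cong k$ and $HH^n(R)=0$ for all $n\ge 1$; (IIb) if $R\cong kQ/(Q_{\ge 2})$, then $HH^n(R)\cong k$ for all $n\ge 0$; in particular $R$ has infinite Hochschild dimension; (III) if $R\cong k\widetilde Q$, then $HH^0(R)\cong k^2$ and $HH^n(R)=0$ for all $n\ge 1$. -/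

import Mathlib

open scoped TensorProduct

universe u v w

set_option linter.unusedSectionVars false
set_option linter.unusedSimpArgs false

noncomputable section

/-! ## Hochschild cohomology

An `A`-bimodule over `k` is a `k`-module `M` with commuting left and right `A`-actions (the right
action is an action of `Aᵐᵒᵖ`) that both restrict to the given action of `k`. -/

section Hochschild

variable (k : Type u) [Field k] (A : Type v) [Ring A] [Algebra k A]
variable (M : Type w) [AddCommGroup M] [Module k M] [Module A M] [Module Aᵐᵒᵖ M]
  [IsScalarTower k A M] [IsScalarTower k Aᵐᵒᵖ M] [SMulCommClass A Aᵐᵒᵖ M]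

/-- Hochschild `n`-cochains: the `k`-multilinear maps `Aⁿ → M`. -/
abbrev HochschildCochain (n : ℕ) : Type (max v w) := MultilinearMap k (fun _ : Fin n => A) M

variable {A}

theorem contractNth_update {n : ℕ} (j : Fin n) (a : Fin (n + 1) → A) (i : Fin (n + 1)) :
    ∃ (l : Fin n) (c : A →ₗ[k] A), ∀ z : A,
      Fin.contractNth j.castSucc (· * ·) (Function.update a i z) =
        Function.update (Fin.contractNth j.castSucc (· * ·) a) l (c z) := by
  rcases lt_trichotomy i.val j.val with h | h | h
  · refine ⟨⟨i, by omega⟩, LinearMap.id, fun z => ?_⟩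
    ext m
    by_cases hm : m.val = i.val <;>
      simp [Fin.contractNth, Function.update_apply, Fin.ext_iff] <;> grind
  · refine ⟨⟨i, by omega⟩, LinearMap.mulRight k (a j.succ), fun z => ?_⟩
    ext m
    obtain rfl : i = j.castSucc := Fin.ext h
    by_cases hm : m = j
    · subst hm
      simp [Fin.contractNth, Function.update_apply, Fin.ext_iff]
    · have : m.val ≠ j.val := fun h => hm (Fin.ext h)
      simp [Fin.contractNth, Function.update_apply, Fin.ext_iff]
      grind
  · by_cases h' : i.val = j.val + 1
    · obtain rfl : i = j.succ := Fin.ext h'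
      refine ⟨j, LinearMap.mulLeft k (a j.castSucc), fun z => ?_⟩
      ext m
      by_cases hm : m = j
      · subst hm
        simp [Fin.contractNth, Function.update_apply, Fin.ext_iff]
      · have : m.val ≠ j.val := fun h => hm (Fin.ext h)
        simp [Fin.contractNth, Function.update_apply, Fin.ext_iff]
        grind
    · refine ⟨⟨i - 1, by omega⟩, LinearMap.id, fun z => ?_⟩
      ext m
      by_cases hm : m.val + 1 = i.val <;>
        simp [Fin.contractNth, Function.update_apply, Fin.ext_iff] <;> grind

variable {k M}

/-- The cochain `(a₀, …, aₙ) ↦ a₀ · f (a₁, …, aₙ)`. -/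
def hochschildLeft {n : ℕ} (f : HochschildCochain k A M n) : HochschildCochain k A M (n + 1) :=
  MultilinearMap.mk' (fun a => a 0 • f (Fin.tail a))
    (by
      intro a i x y
      refine Fin.cases ?_ (fun i => ?_) i
      · simp [add_smul]
      · simp [Fin.tail_update_succ, Function.update_of_ne (Fin.succ_ne_zero i).symm])
    (by
      intro a i c x
      refine Fin.cases ?_ (fun i => ?_) i
      · simp
      · simp [Fin.tail_update_succ, Function.update_of_ne (Fin.succ_ne_zero i).symm,
          smul_comm _ c])

/-- The cochain `(a₀, …, aₙ) ↦ f (a₀, …, aⱼ aⱼ₊₁, …, aₙ)`. -/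
def hochschildMiddle {n : ℕ} (j : Fin n) (f : HochschildCochain k A M n) :
    HochschildCochain k A M (n + 1) :=
  MultilinearMap.mk' (fun a => f (Fin.contractNth j.castSucc (· * ·) a))
    (by
      intro a i x y
      obtain ⟨l, c, h⟩ := contractNth_update k j a i
      simp [h])
    (by
      intro a i r x
      obtain ⟨l, c, h⟩ := contractNth_update k j a i
      simp [h])

/-- The cochain `(a₀, …, aₙ) ↦ f (a₀, …, aₙ₋₁) · aₙ`. -/
def hochschildRight {n : ℕ} (f : HochschildCochain k A M n) : HochschildCochain k A M (n + 1) :=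
  MultilinearMap.mk' (fun a => MulOpposite.op (a (Fin.last n)) • f (Fin.init a))
    (by
      intro a i x y
      refine Fin.lastCases ?_ (fun i => ?_) i
      · simp [add_smul]
      · simp [Fin.init_update_castSucc, Function.update_of_ne (Fin.castSucc_ne_last i).symm])
    (by
      intro a i c x
      refine Fin.lastCases ?_ (fun i => ?_) i
      · simp
      · simp [Fin.init_update_castSucc, Function.update_of_ne (Fin.castSucc_ne_last i).symm,
          smul_comm _ c])

theorem hochschildLeft_apply {n : ℕ} (f : HochschildCochain k A M n) (a : Fin (n + 1) → A) :
    hochschildLeft f a = a 0 • f (Fin.tail a) := rfl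

theorem hochschildMiddle_apply {n : ℕ} (j : Fin n) (f : HochschildCochain k A M n)
    (a : Fin (n + 1) → A) :
    hochschildMiddle j f a = f (Fin.contractNth j.castSucc (· * ·) a) := rfl

theorem hochschildRight_apply {n : ℕ} (f : HochschildCochain k A M n) (a : Fin (n + 1) → A) :
    hochschildRight f a = MulOpposite.op (a (Fin.last n)) • f (Fin.init a) := rfl

variable (k A M)

/-- The Hochschild coboundary
`(d f)(a₀, …, aₙ) = a₀ f(a₁, …, aₙ) + ∑ⱼ (-1)^(j+1) f(a₀, …, aⱼ aⱼ₊₁, …, aₙ)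
  + (-1)^(n+1) f(a₀, …, aₙ₋₁) aₙ`. -/
def hochschildD (n : ℕ) : HochschildCochain k A M n →ₗ[k] HochschildCochain k A M (n + 1) where
  toFun f := hochschildLeft f + ∑ j : Fin n, (-1 : k) ^ (j.val + 1) • hochschildMiddle j f
    + (-1 : k) ^ (n + 1) • hochschildRight f
  map_add' f g := by
    ext a
    simp only [hochschildLeft_apply, hochschildMiddle_apply, hochschildRight_apply, add_apply,
      sum_apply, smul_apply, smul_add, Finset.sum_add_distrib]
    abel
  map_smul' c f := by
    ext a
    simp only [hochschildLeft_apply, hochschildMiddle_apply, hochschildRight_apply, add_apply,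
      sum_apply, smul_apply, smul_add, Finset.smul_sum, RingHom.id_apply, smul_comm _ c]

theorem hochschildD_apply (n : ℕ) (f : HochschildCochain k A M n) (a : Fin (n + 1) → A) :
    hochschildD k A M n f a = a 0 • f (Fin.tail a)
      + ∑ j : Fin n, (-1 : k) ^ (j.val + 1) • f (Fin.contractNth j.castSucc (· * ·) a)
      + (-1 : k) ^ (n + 1) • MulOpposite.op (a (Fin.last n)) • f (Fin.init a) := by
  simp only [hochschildD, LinearMap.coe_mk, AddHom.coe_mk, hochschildLeft_apply,
    hochschildMiddle_apply, hochschildRight_apply, add_apply, sum_apply, smul_apply]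

variable {k A M}

/-- All faces together: left multiplication, the inner products, right multiplication. -/
def hochschildFace {n : ℕ} (i : Fin (n + 2)) (f : HochschildCochain k A M n) :
    HochschildCochain k A M (n + 1) :=
  Fin.cases (hochschildLeft f)
    (fun i => Fin.lastCases (hochschildRight f) (fun j => hochschildMiddle j f) i) i

theorem hochschildFace_apply {n : ℕ} (i : Fin (n + 2)) (f : HochschildCochain k A M n)
    (a : Fin (n + 1) → A) :
    hochschildFace i f a =
      (if i.val = 0 then a 0 else 1) •
      (MulOpposite.op (if i.val = n + 1 then a (Fin.last n) else 1)) •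
      f (fun l => if l.val + 1 < i.val then a l.castSucc
        else if l.val + 1 = i.val then a l.castSucc * a l.succ else a l.succ) := by
  refine Fin.cases ?_ (fun i => Fin.lastCases ?_ (fun j => ?_) i) i
  · simp [hochschildFace, hochschildLeft_apply, Fin.tail_def]
  · simp only [hochschildFace, Fin.cases_succ, Fin.lastCases_last, hochschildRight_apply]
    simp
    congr 2
  · have := j.2.ne
    simp only [hochschildFace, Fin.cases_succ, Fin.lastCases_castSucc, hochschildMiddle_apply]
    simp only [Fin.val_succ, Fin.val_castSucc, Nat.add_eq_zero_iff, one_ne_zero, and_false,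
      if_false, add_left_inj, this, MulOpposite.op_one, one_smul]
    congr 1
    funext l
    simp only [Fin.contractNth, Fin.val_castSucc, add_lt_add_iff_right]

theorem hochschildD_eq_sum (n : ℕ) (f : HochschildCochain k A M n) :
    hochschildD k A M n f = ∑ i : Fin (n + 2), (-1 : k) ^ i.val • hochschildFace i f := by
  rw [Fin.sum_univ_succ, Fin.sum_univ_castSucc]
  have h : hochschildFace (Fin.last n).succ f = hochschildRight f := by
    simp only [hochschildFace, Fin.cases_succ, Fin.lastCases_last]
  have h' (j : Fin n) : hochschildFace j.castSucc.succ f = hochschildMiddle j f := by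
    simp only [hochschildFace, Fin.cases_succ, Fin.lastCases_castSucc]
  have h0 : hochschildFace 0 f = hochschildLeft f := rfl
  simp [hochschildD, h, h', h0, add_assoc, -Fin.succ_last]

theorem hochschildFace_comm {n : ℕ} (i j : Fin (n + 2)) (h : i ≤ j)
    (f : HochschildCochain k A M n) :
    hochschildFace j.succ (hochschildFace i f) = hochschildFace i.castSucc (hochschildFace j f) := by
  ext a
  have hij : i.val ≤ j.val := h
  have hj := j.2
  simp only [hochschildFace_apply, Fin.val_succ, Fin.val_castSucc]
  have key (p q r s : A) (m : M) : p • MulOpposite.op q • r • MulOpposite.op s • m =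
      (p * r) • MulOpposite.op (s * q) • m := by
    rw [← smul_comm r, smul_smul, smul_smul, MulOpposite.op_mul]
  simp only [key]
  congr 1
  · rcases eq_or_ne i.val 0 with hi | hi <;> rcases eq_or_ne j.val 0 with hj0 | hj0 <;>
      simp [hi, hj0] <;> grind
  congr 1
  · have hi2 : i.val ≠ n + 2 := by omega
    congr 1
    rcases eq_or_ne i.val (n + 1) with hi | hi <;> rcases eq_or_ne j.val (n + 1) with hj0 | hj0 <;>
      simp [hi, hj0, hi2] <;> grind
  congr 1
  funext l
  have e : l.castSucc.succ = l.succ.castSucc := rfl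
  rw [e]
  grind

/-- The Hochschild coboundary squares to zero. -/
theorem hochschildD_hochschildD (n : ℕ) (f : HochschildCochain k A M n) :
    hochschildD k A M (n + 1) (hochschildD k A M n f) = 0 := by
  have hl {m : ℕ} (i : Fin (m + 2)) (c : k) (g : HochschildCochain k A M m) :
      hochschildFace i (c • g) = c • hochschildFace i g := by
    ext a
    simp only [hochschildFace_apply, smul_apply, smul_comm _ c]
  have hs {m : ℕ} (i : Fin (m + 2)) {ι : Type} (s : Finset ι)
      (g : ι → HochschildCochain k A M m) :
      hochschildFace i (∑ j ∈ s, g j) = ∑ j ∈ s, hochschildFace i (g j) := by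
    ext a
    simp only [hochschildFace_apply, sum_apply, Finset.smul_sum]
  simp only [hochschildD_eq_sum, hs, hl, Finset.smul_sum, smul_smul]
  rw [← Finset.sum_product', Finset.univ_product_univ]
  let P := Fin (n + 3) × Fin (n + 2)
  let S : Finset P := {p : P | p.1.val ≤ p.2.val}
  change ∑ p : P, _ = 0
  rw [← Finset.sum_add_sum_compl S, ← eq_neg_iff_add_eq_zero, ← Finset.sum_neg_distrib]
  have memS (p : P) : p ∈ S ↔ p.1.val ≤ p.2.val := by simp [S]
  refine Finset.sum_bij' (fun p hp => (p.2.succ, ⟨p.1, by have := (memS p).1 hp; omega⟩))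
    (fun p hp => (p.2.castSucc, ⟨p.1 - 1, by
      have := (memS p).not.1 (Finset.mem_compl.1 hp); omega⟩)) ?_ ?_ ?_ ?_ ?_
  · intro p hp
    have := (memS p).1 hp
    simp [memS]
    omega
  · intro p hp
    have := (memS p).not.1 (Finset.mem_compl.1 hp)
    simp [memS]
    omega
  · intro p hp
    rfl
  · intro p hp
    have := (memS p).not.1 (Finset.mem_compl.1 hp)
    ext
    · simp; omega
    · rfl
  · intro p hp
    have := (memS p).1 hp
    have hc := hochschildFace_comm (⟨p.1, by omega⟩ : Fin (n + 2)) p.2 (by simpa [Fin.le_def]) f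
    have e : (⟨p.1, by omega⟩ : Fin (n + 2)).castSucc = p.1 := rfl
    rw [e] at hc
    rw [hc, ← neg_smul]
    congr 1
    simp only [Fin.val_succ]
    ring

variable (k A M)

/-- Hochschild `n`-coboundaries: the image of `Cⁿ⁻¹`, which is zero for `n = 0`. -/
def hochschildCoboundaries : (n : ℕ) → Submodule k (HochschildCochain k A M n)
  | 0 => ⊥
  | n + 1 => LinearMap.range (hochschildD k A M n)

/-- The Hochschild cohomology `HHⁿ(A, M)`: cocycles modulo coboundaries. -/
abbrev HochschildCohomology (n : ℕ) : Type (max v w) :=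
  LinearMap.ker (hochschildD k A M n) ⧸
    (hochschildCoboundaries k A M n).submoduleOf (LinearMap.ker (hochschildD k A M n))

/-- `HHⁿ(A) = HHⁿ(A, A)`. -/
abbrev HH (n : ℕ) : Type v := HochschildCohomology k A A n

/-- The Hochschild dimension of `A`: the supremum of the `n` for which some `A`-bimodule `M` has
`HHⁿ(A, M) ≠ 0`. -/
def hochschildDim : ℕ∞ :=
  sSup {d : ℕ∞ | ∃ (n : ℕ) (M : Type v) (_ : AddCommGroup M) (_ : Module k M) (_ : Module A M)
    (_ : Module Aᵐᵒᵖ M) (_ : IsScalarTower k A M) (_ : IsScalarTower k Aᵐᵒᵖ M)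
    (_ : SMulCommClass A Aᵐᵒᵖ M), Nontrivial (HochschildCohomology k A M n) ∧ d = n}

end Hochschild

/-! ## Twisted tensor products -/

section Twisted

variable (k : Type u) [Field k] (A : Type v) [Ring A] [Algebra k A] (B : Type w) [Ring B]
  [Algebra k B]

/-- A twisting map `τ : B ⊗ A → A ⊗ B`. -/
structure TwistingMap where
  /-- The underlying linear map. -/
  toLin : B ⊗[k] A →ₗ[k] A ⊗[k] B
  map_one_right : ∀ b : B, toLin (b ⊗ₜ 1) = 1 ⊗ₜ b
  map_one_left : ∀ a : A, toLin (1 ⊗ₜ a) = a ⊗ₜ 1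
  /-- `τ ∘ (B ⊗ μ_A) = (μ_A ⊗ B) ∘ (A ⊗ τ) ∘ (τ ⊗ A)` -/
  map_mul_right :
    toLin ∘ₗ (LinearMap.mul' k A).lTensor B ∘ₗ (TensorProduct.assoc k B A A).toLinearMap =
      (LinearMap.mul' k A).rTensor B ∘ₗ (TensorProduct.assoc k A A B).symm.toLinearMap ∘ₗ
        toLin.lTensor A ∘ₗ (TensorProduct.assoc k A B A).toLinearMap ∘ₗ toLin.rTensor A
  /-- `τ ∘ (μ_B ⊗ A) = (A ⊗ μ_B) ∘ (τ ⊗ B) ∘ (B ⊗ τ)` -/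
  map_mul_left :
    toLin ∘ₗ (LinearMap.mul' k B).rTensor A ∘ₗ (TensorProduct.assoc k B B A).symm.toLinearMap =
      (LinearMap.mul' k B).lTensor A ∘ₗ (TensorProduct.assoc k A B B).toLinearMap ∘ₗ
        toLin.rTensor B ∘ₗ (TensorProduct.assoc k B A B).symm.toLinearMap ∘ₗ toLin.lTensor B

variable {k A B}

/-- The twisted tensor product `A ⊗_τ B`; its underlying vector space is `A ⊗ B`. -/
def TwistedTensorProduct (_τ : TwistingMap k A B) : Type (max v w) := A ⊗[k] B

namespace TwistedTensorProduct

variable (τ : TwistingMap k A B)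

instance : AddCommGroup (TwistedTensorProduct τ) := inferInstanceAs (AddCommGroup (A ⊗[k] B))

instance : Module k (TwistedTensorProduct τ) := inferInstanceAs (Module k (A ⊗[k] B))

/-- The product `μ_τ = (μ_A ⊗ μ_B) ∘ (A ⊗ τ ⊗ B)`. -/
def mulMap : (A ⊗[k] B) ⊗[k] (A ⊗[k] B) →ₗ[k] A ⊗[k] B :=
  TensorProduct.map (LinearMap.mul' k A) (LinearMap.mul' k B) ∘ₗ
    (TensorProduct.assoc k A A (B ⊗[k] B)).symm.toLinearMap ∘ₗ
    ((TensorProduct.assoc k A B B).toLinearMap ∘ₗ τ.toLin.rTensor B ∘ₗ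
      (TensorProduct.assoc k B A B).symm.toLinearMap).lTensor A ∘ₗ
    (TensorProduct.assoc k A B (A ⊗[k] B)).toLinearMap

theorem mulMap_tmul (a a' : A) (b b' : B) :
    mulMap τ ((a ⊗ₜ b) ⊗ₜ (a' ⊗ₜ b')) =
      TensorProduct.map (LinearMap.mulLeft k a) (LinearMap.mulRight k b')
        (τ.toLin (b ⊗ₜ a')) := by
  simp only [mulMap, LinearMap.comp_apply, LinearEquiv.coe_coe, TensorProduct.assoc_tmul,
    LinearMap.lTensor_tmul, TensorProduct.assoc_symm_tmul, LinearMap.rTensor_tmul]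
  induction τ.toLin (b ⊗ₜ a') with
  | zero => simp
  | tmul x y => simp
  | add x y hx hy => simp only [TensorProduct.add_tmul, map_add, TensorProduct.tmul_add, hx, hy]

theorem toLin_mul_right (b : B) (a a' : A) :
    τ.toLin (b ⊗ₜ (a * a')) = mulMap τ (τ.toLin (b ⊗ₜ a) ⊗ₜ (a' ⊗ₜ 1)) := by
  have h := LinearMap.congr_fun τ.map_mul_right ((b ⊗ₜ a) ⊗ₜ a')
  simp only [LinearMap.comp_apply, LinearEquiv.coe_coe, TensorProduct.assoc_tmul,
    LinearMap.lTensor_tmul, LinearMap.mul'_apply, LinearMap.rTensor_tmul] at h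
  rw [h]
  induction τ.toLin (b ⊗ₜ a) with
  | zero => simp
  | tmul x y =>
    rw [mulMap_tmul, TensorProduct.assoc_tmul, LinearMap.lTensor_tmul]
    induction τ.toLin (y ⊗ₜ a') with
    | zero => simp
    | tmul x y => simp
    | add x y hx hy => simp only [map_add, TensorProduct.tmul_add, hx, hy]
  | add x y hx hy => simp only [map_add, TensorProduct.add_tmul, hx, hy]

theorem toLin_mul_left (b b' : B) (a : A) :
    τ.toLin ((b * b') ⊗ₜ a) = mulMap τ ((1 ⊗ₜ b) ⊗ₜ τ.toLin (b' ⊗ₜ a)) := by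
  have h := LinearMap.congr_fun τ.map_mul_left (b ⊗ₜ (b' ⊗ₜ a))
  simp only [LinearMap.comp_apply, LinearEquiv.coe_coe, TensorProduct.assoc_symm_tmul,
    LinearMap.lTensor_tmul, LinearMap.mul'_apply, LinearMap.rTensor_tmul] at h
  rw [h]
  induction τ.toLin (b' ⊗ₜ a) with
  | zero => simp
  | tmul x y =>
    rw [mulMap_tmul, TensorProduct.assoc_symm_tmul, LinearMap.rTensor_tmul]
    induction τ.toLin (b ⊗ₜ x) with
    | zero => simp
    | tmul x y => simp
    | add x y hx hy => simp only [map_add, TensorProduct.add_tmul, hx, hy]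
  | add x y hx hy => simp only [map_add, TensorProduct.tmul_add, hx, hy]

theorem mulMap_map_left (a : A) (b : B) (x : A ⊗[k] B) (a' : A) (b' : B) :
    mulMap τ ((TensorProduct.map (LinearMap.mulLeft k a) (LinearMap.mulRight k b) x) ⊗ₜ
      (a' ⊗ₜ b')) =
    TensorProduct.map (LinearMap.mulLeft k a) (LinearMap.mulRight k b')
      (mulMap τ (x ⊗ₜ τ.toLin (b ⊗ₜ a'))) := by
  induction x with
  | zero => simp
  | add x y hx hy => simp only [map_add, TensorProduct.add_tmul, hx, hy]
  | tmul x y =>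
    rw [TensorProduct.map_tmul, mulMap_tmul, LinearMap.mulRight_apply, toLin_mul_left]
    induction τ.toLin (b ⊗ₜ a') with
    | zero => simp
    | add x y hx hy => simp only [map_add, TensorProduct.tmul_add, hx, hy]
    | tmul z w =>
      rw [mulMap_tmul, mulMap_tmul]
      induction τ.toLin (y ⊗ₜ z) with
      | zero => simp
      | add x y hx hy => simp only [map_add, hx, hy]
      | tmul s t => simp [mul_assoc]

theorem mulMap_map_right (a : A) (b : B) (a' : A) (b' : B) (x : A ⊗[k] B) :
    mulMap τ ((a ⊗ₜ b) ⊗ₜ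
      (TensorProduct.map (LinearMap.mulLeft k a') (LinearMap.mulRight k b') x)) =
    TensorProduct.map (LinearMap.mulLeft k a) (LinearMap.mulRight k b')
      (mulMap τ (τ.toLin (b ⊗ₜ a') ⊗ₜ x)) := by
  induction x with
  | zero => simp
  | add x y hx hy => simp only [map_add, TensorProduct.tmul_add, hx, hy]
  | tmul x y =>
    rw [TensorProduct.map_tmul, mulMap_tmul, LinearMap.mulLeft_apply, toLin_mul_right]
    induction τ.toLin (b ⊗ₜ a') with
    | zero => simp
    | add x y hx hy => simp only [map_add, TensorProduct.add_tmul, hx, hy]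
    | tmul z w =>
      rw [mulMap_tmul, mulMap_tmul]
      induction τ.toLin (w ⊗ₜ x) with
      | zero => simp
      | add x y hx hy => simp only [map_add, hx, hy]
      | tmul s t => simp [mul_assoc]

theorem mulMap_assoc (x y z : A ⊗[k] B) :
    mulMap τ (mulMap τ (x ⊗ₜ y) ⊗ₜ z) = mulMap τ (x ⊗ₜ mulMap τ (y ⊗ₜ z)) := by
  induction x with
  | zero => simp
  | add x x' hx hx' => simp only [map_add, TensorProduct.add_tmul, hx, hx']
  | tmul a b =>
    induction y with
    | zero => simp
    | add y y' hy hy' => simp only [map_add, TensorProduct.add_tmul, TensorProduct.tmul_add, hy, hy']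
    | tmul a' b' =>
      induction z with
      | zero => simp
      | add z z' hz hz' => simp only [map_add, TensorProduct.tmul_add, hz, hz']
      | tmul a'' b'' =>
        rw [mulMap_tmul, mulMap_tmul, mulMap_map_left, mulMap_map_right]

theorem mulMap_smul_left (r : k) (x y : A ⊗[k] B) :
    mulMap τ ((r • x) ⊗ₜ y) = r • mulMap τ (x ⊗ₜ y) := by
  rw [← TensorProduct.smul_tmul', map_smul]

theorem mulMap_smul_right (r : k) (x y : A ⊗[k] B) :
    mulMap τ (x ⊗ₜ (r • y)) = r • mulMap τ (x ⊗ₜ y) := by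
  rw [TensorProduct.tmul_smul, map_smul]

instance : Ring (TwistedTensorProduct τ) where
  __ := (inferInstance : AddCommGroup (TwistedTensorProduct τ))
  mul x y := mulMap τ (x ⊗ₜ[k] y)
  one := ((1 : A) ⊗ₜ[k] (1 : B) : A ⊗[k] B)
  left_distrib x y z := (congrArg (mulMap τ) (TensorProduct.tmul_add x y z)).trans (map_add _ _ _)
  right_distrib x y z := (congrArg (mulMap τ) (TensorProduct.add_tmul x y z)).trans (map_add _ _ _)
  zero_mul x := (congrArg (mulMap τ) (TensorProduct.zero_tmul _ x)).trans (map_zero _)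
  mul_zero x := (congrArg (mulMap τ) (TensorProduct.tmul_zero _ x)).trans (map_zero _)
  mul_assoc x y z := mulMap_assoc τ x y z
  one_mul x := by
    change mulMap τ (((1 : A) ⊗ₜ[k] (1 : B)) ⊗ₜ[k] x) = x
    induction x using TensorProduct.induction_on with
    | zero => exact (congrArg (mulMap τ) (TensorProduct.tmul_zero _ _)).trans (map_zero _)
    | add x y hx hy =>
      exact (congrArg (mulMap τ) (TensorProduct.tmul_add _ x y)).trans
        ((map_add _ _ _).trans (congrArg₂ _ hx hy))
    | tmul a b => rw [mulMap_tmul, τ.map_one_left]; simp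
  mul_one x := by
    change mulMap τ (x ⊗ₜ[k] ((1 : A) ⊗ₜ[k] (1 : B))) = x
    induction x using TensorProduct.induction_on with
    | zero => exact (congrArg (mulMap τ) (TensorProduct.zero_tmul _ _)).trans (map_zero _)
    | add x y hx hy =>
      exact (congrArg (mulMap τ) (TensorProduct.add_tmul x y _)).trans
        ((map_add _ _ _).trans (congrArg₂ _ hx hy))
    | tmul a b => rw [mulMap_tmul, τ.map_one_right]; simp

instance : Algebra k (TwistedTensorProduct τ) :=
  Algebra.ofModule (mulMap_smul_left τ) (mulMap_smul_right τ)

end TwistedTensorProduct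

end Twisted

/-! ## Path algebras -/

section PathAlgebra

/-- All paths of a quiver, as triples (source, target, path). -/
abbrev QuiverPath (V : Type v) [Quiver.{w} V] : Type (max v w) := Σ a b : V, Quiver.Path a b

/-- The path algebra `kV`: the vector space with the paths of the quiver as a basis. -/
def PathAlgebra (k : Type u) [Field k] (V : Type v) [Quiver.{w} V] : Type (max u v w) :=
  QuiverPath V →₀ k

namespace PathAlgebra

variable (k : Type u) [Field k] {V : Type v} [Quiver.{w} V]

instance : AddCommGroup (PathAlgebra k V) := inferInstanceAs (AddCommGroup (QuiverPath V →₀ k))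

instance : Module k (PathAlgebra k V) := inferInstanceAs (Module k (QuiverPath V →₀ k))

/-- The basis element of a path. -/
def of (p : QuiverPath V) : PathAlgebra k V := Finsupp.single p (1 : k)

variable [DecidableEq V]

/-- The product of two basis elements: `p * q` is the path `q` followed by `p` if `q` ends where
`p` starts, and `0` otherwise. -/
def pathMul (p q : QuiverPath V) : PathAlgebra k V :=
  if h : q.2.1 = p.1 then of k ⟨q.1, p.2.1, (q.2.2.cast rfl h).comp p.2.2⟩ else 0

/-- The bilinear extension of `pathMul`. -/
def mulMap : PathAlgebra k V →ₗ[k] PathAlgebra k V →ₗ[k] PathAlgebra k V :=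
  Finsupp.linearCombination k (fun p => Finsupp.linearCombination k (fun q => pathMul k p q))

theorem mulMap_of (p q : QuiverPath V) : mulMap k (of k p) (of k q) = pathMul k p q := by
  unfold mulMap of
  erw [Finsupp.linearCombination_single, one_smul, Finsupp.linearCombination_single, one_smul]

theorem induction {P : PathAlgebra k V → Prop} (x : PathAlgebra k V) (h0 : P 0)
    (hadd : ∀ x y, P x → P y → P (x + y)) (hof : ∀ (c : k) p, P (c • of k p)) : P x := by
  refine Finsupp.induction_linear x h0 hadd fun p c => ?_
  have h : Finsupp.single p c = c • of k p := (Finsupp.smul_single_one p c).symm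
  exact h ▸ hof c p

theorem mulMap_assoc_of (p q r : QuiverPath V) :
    mulMap k (pathMul k p q) (of k r) = mulMap k (of k p) (pathMul k q r) := by
  obtain ⟨a, b, p⟩ := p
  obtain ⟨c, d, q⟩ := q
  obtain ⟨e, f, r⟩ := r
  by_cases h : d = a <;> by_cases h' : f = c
  · subst h h'
    simp [pathMul, mulMap_of]
  · subst h
    simp [pathMul, mulMap_of, h']
  · subst h'
    simp [pathMul, mulMap_of, h]
  · simp [pathMul, h, h']

theorem mulMap_assoc (x y z : PathAlgebra k V) :
    mulMap k (mulMap k x y) z = mulMap k x (mulMap k y z) := by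
  induction x using PathAlgebra.induction with
  | h0 => simp
  | hadd x x' hx hx' => simp only [map_add, LinearMap.add_apply, hx, hx']
  | hof s p =>
    induction y using PathAlgebra.induction with
    | h0 => simp
    | hadd y y' hy hy' => simp only [map_add, LinearMap.add_apply, hy, hy']
    | hof t q =>
      induction z using PathAlgebra.induction with
      | h0 => simp
      | hadd z z' hz hz' => simp only [map_add, hz, hz']
      | hof u r =>
        simp only [map_smul, LinearMap.smul_apply, mulMap_of, mulMap_assoc_of]

variable [Fintype V]

instance : Ring (PathAlgebra k V) where
  __ := (inferInstance : AddCommGroup (PathAlgebra k V))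
  mul x y := mulMap k x y
  one := ∑ v : V, of k ⟨v, v, Quiver.Path.nil⟩
  left_distrib x y z := map_add (mulMap k x) y z
  right_distrib x y z := LinearMap.map_add₂ (mulMap k) x y z
  zero_mul x := LinearMap.map_zero₂ (mulMap k) x
  mul_zero x := map_zero (mulMap k x)
  mul_assoc x y z := mulMap_assoc k x y z
  one_mul x := by
    change mulMap k (∑ v : V, of k ⟨v, v, Quiver.Path.nil⟩) x = x
    induction x using PathAlgebra.induction with
    | h0 => exact map_zero _
    | hadd x y hx hy => exact (map_add _ _ _).trans (congrArg₂ _ hx hy)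
    | hof c p =>
      obtain ⟨a, b, p⟩ := p
      rw [map_smul, map_sum, LinearMap.sum_apply, Finset.sum_eq_single b]
      · simp [mulMap_of, pathMul]
      · intro v _ hv
        simp [mulMap_of, pathMul, hv.symm]
      · simp
  mul_one x := by
    change mulMap k x (∑ v : V, of k ⟨v, v, Quiver.Path.nil⟩) = x
    induction x using PathAlgebra.induction with
    | h0 => exact LinearMap.map_zero₂ _ _
    | hadd x y hx hy => exact (LinearMap.map_add₂ _ _ _ _).trans (congrArg₂ _ hx hy)
    | hof c p =>
      obtain ⟨a, b, p⟩ := p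
      rw [map_smul, LinearMap.smul_apply, map_sum, Finset.sum_eq_single a]
      · simp [mulMap_of, pathMul]
      · intro v _ hv
        simp [mulMap_of, pathMul, hv]
      · simp

instance : Algebra k (PathAlgebra k V) :=
  Algebra.ofModule (fun r x y => LinearMap.map_smul₂ (mulMap k) r x y)
    (fun r x y => map_smul (mulMap k x) r y)

variable (V)

/-- The two-sided ideal generated by the paths of length at least two. -/
def idealGETwo : TwoSidedIdeal (PathAlgebra k V) :=
  TwoSidedIdeal.span {x | ∃ p : QuiverPath V, 2 ≤ p.2.2.length ∧ x = of k p}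

/-- The quotient of the path algebra by the ideal generated by the paths of length at least two. -/
abbrev ModGETwo : Type _ := (idealGETwo k V).ringCon.Quotient

end PathAlgebra

/-- The vertices of the round-trip quiver. -/
inductive RoundTrip : Type
  | e | f
  deriving DecidableEq

/-- The arrows of the round-trip quiver: one in each direction. -/
inductive RoundTrip.Arrow : RoundTrip → RoundTrip → Type
  | x : RoundTrip.Arrow RoundTrip.e RoundTrip.f
  | y : RoundTrip.Arrow RoundTrip.f RoundTrip.e

instance : Fintype RoundTrip := ⟨{RoundTrip.e, RoundTrip.f}, fun v => by cases v <;> simp⟩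

instance : Quiver RoundTrip := ⟨RoundTrip.Arrow⟩

/-- The vertices of the quiver with three vertices and a single arrow, joining two of them. -/
inductive ArrowAndPoint : Type
  | source | target | point
  deriving DecidableEq

/-- The only arrow. -/
inductive ArrowAndPoint.Arrow : ArrowAndPoint → ArrowAndPoint → Type
  | arrow : ArrowAndPoint.Arrow ArrowAndPoint.source ArrowAndPoint.target

instance : Fintype ArrowAndPoint :=
  ⟨{ArrowAndPoint.source, ArrowAndPoint.target, ArrowAndPoint.point}, fun v => by cases v <;> simp⟩

instance : Quiver ArrowAndPoint := ⟨ArrowAndPoint.Arrow⟩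

end PathAlgebra

end

/-! The cohomology is computed relative to a separable subalgebra `E` of the algebra `A`. Let `∑ xᵢ
⊗ yᵢ` be a separability idempotent of `E`. Inserting the pair `xᵢ, yᵢ` between two arguments of a
cochain gives a homotopy, and subtracting its coboundary makes a cocycle vanish whenever one more
argument lies in `E` (`SeparabilityData.vanishesAt_sub`). Treating the arguments from left to right
shows that every cocycle of positive degree is cohomologous to a normalized one
(`SeparabilityData.exists_vanishesAt`). If a cochain and its coboundary are both normalized, the
cochain is also `E`-balanced (`isRelative_of_vanishesAt`): when an argument of the coboundary lies
in `E`, only two neighbouring faces survive, so they agree. What remains are `E`-bimodule maps on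
tensor powers of `A/E` over `E`, a very small space here.

In degree zero the cohomology is the centre. For `k⁴` and the matrix algebra take `E = A`: a
normalized cochain of positive degree is zero.

For the two quiver algebras `E` is spanned by the vertex idempotents. With a single arrow, two
arrows never compose, so a normalized balanced cochain of degree at least two is zero. In degree one
it sends the arrow to a multiple of itself, and is an inner derivation.

For the round trip modulo paths of length two, the only composable strings of `n` arrows are the two
alternating ones. A normalized balanced cochain is therefore given by a function `c` on the two
vertices (`exists_eq_alternatingCochain`). Inner faces of the coboundary vanish because two arrows
multiply to zero. From even to odd degree the two outer faces give `c (swap i) - c i`; from odd to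
even degree they vanish as well. The complex is thus `k² → k² → k² → ⋯` with maps alternately of
rank one and zero, in every characteristic, and each cohomology space is one-dimensional.
Nonvanishing in all degrees gives infinite Hochschild dimension.

The statements on twisted tensor products follow by transport along algebra isomorphisms
(`HH.congr`). -/

noncomputable section

/-! ### Invariance under algebra isomorphisms -/

section Invariance

variable {k : Type u} [Field k] {A : Type v} [Ring A] [Algebra k A] {B : Type w} [Ring B]
  [Algebra k B]

/-- Transport of Hochschild cochains along an algebra isomorphism. -/
def hochschildCochainCongr (φ : A ≃ₐ[k] B) (n : ℕ) :
    HochschildCochain k A A n ≃ₗ[k] HochschildCochain k B B n where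
  toFun f := φ.toLinearMap.compMultilinearMap (f.compLinearMap fun _ => φ.symm.toLinearMap)
  invFun f := φ.symm.toLinearMap.compMultilinearMap (f.compLinearMap fun _ => φ.toLinearMap)
  map_add' f g := by ext; simp
  map_smul' c f := by ext; simp
  left_inv f := by ext; simp
  right_inv f := by ext; simp

theorem hochschildCochainCongr_apply (φ : A ≃ₐ[k] B) (n : ℕ) (f : HochschildCochain k A A n)
    (b : Fin n → B) : hochschildCochainCongr φ n f b = φ (f fun i => φ.symm (b i)) := rfl

theorem hochschildD_cochainCongr (φ : A ≃ₐ[k] B) (n : ℕ) (f : HochschildCochain k A A n) :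
    hochschildD k B B n (hochschildCochainCongr φ n f) =
      hochschildCochainCongr φ (n + 1) (hochschildD k A A n f) := by
  ext b
  have h (j : Fin n) : (fun i => φ.symm (Fin.contractNth j.castSucc (· * ·) b i)) =
      Fin.contractNth j.castSucc (· * ·) (fun i => φ.symm (b i)) :=
    Fin.comp_contractNth (f := φ.symm) (· * ·) (· * ·) (fun x y => map_mul φ.symm x y) _ b
  simp only [hochschildD_apply, hochschildCochainCongr_apply, h, map_add, map_sum, map_smul,
    smul_eq_mul, op_smul_eq_mul, map_mul, AlgEquiv.apply_symm_apply]
  rfl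

theorem hochschildCoboundaries_map (φ : A ≃ₐ[k] B) (n : ℕ) (f : HochschildCochain k A A n) :
    hochschildCochainCongr φ n f ∈ hochschildCoboundaries k B B n ↔
      f ∈ hochschildCoboundaries k A A n := by
  cases n with
  | zero => simp [hochschildCoboundaries]
  | succ n =>
    simp only [hochschildCoboundaries, LinearMap.mem_range]
    refine ((hochschildCochainCongr φ n).toEquiv.exists_congr fun g => ?_).symm
    change _ ↔ hochschildD k B B n (hochschildCochainCongr φ n g) = _
    rw [hochschildD_cochainCongr, (hochschildCochainCongr φ (n + 1)).injective.eq_iff]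

/-- Transport of Hochschild cocycles along an algebra isomorphism. -/
def hochschildCocyclesCongr (φ : A ≃ₐ[k] B) (n : ℕ) :
    LinearMap.ker (hochschildD k A A n) ≃ₗ[k] LinearMap.ker (hochschildD k B B n) :=
  (hochschildCochainCongr φ n).submoduleMap _ ≪≫ₗ LinearEquiv.ofEq _ _ (by
    ext f
    obtain ⟨f, rfl⟩ := (hochschildCochainCongr φ n).surjective f
    simp only [LinearMap.mem_ker, hochschildD_cochainCongr, LinearEquiv.map_eq_zero_iff,
      Submodule.mem_map, LinearEquiv.coe_coe, EmbeddingLike.apply_eq_iff_eq, exists_eq_right])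

/-- Hochschild cohomology is invariant under algebra isomorphisms. -/
def HH.congr (φ : A ≃ₐ[k] B) (n : ℕ) : HH k A n ≃ₗ[k] HH k B n :=
  Submodule.Quotient.equiv _ _ (hochschildCocyclesCongr φ n) (by
    ext f
    obtain ⟨f, rfl⟩ := (hochschildCocyclesCongr φ n).surjective f
    rw [Submodule.mem_map_equiv, LinearEquiv.symm_apply_apply]
    exact (hochschildCoboundaries_map φ n f.1).symm)

end Invariance

/-! ### Cochains evaluated at infinite sequences, and the insertion homotopy -/

section Normalization

variable {k : Type u} [Field k] {A : Type v} [Ring A] [Algebra k A]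
variable {M : Type w} [AddCommGroup M] [Module k M] [Module A M] [Module Aᵐᵒᵖ M]
  [IsScalarTower k A M] [IsScalarTower k Aᵐᵒᵖ M] [SMulCommClass A Aᵐᵒᵖ M]

/-- The value of a cochain at the beginning of an infinite sequence. -/
def seqEval {n : ℕ} (f : HochschildCochain k A M n) (s : ℕ → A) : M := f fun l => s l

/-- Multiply the entries `i - 1` and `i` of a sequence; drop the first entry if `i = 0`. -/
def mergeAt (i : ℕ) (s : ℕ → A) (l : ℕ) : A :=
  if l + 1 < i then s l else if l + 1 = i then s l * s (l + 1) else s (l + 1)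

/-- Insert two entries at the positions `p` and `p + 1`. -/
def insertTwo (p : ℕ) (x y : A) (s : ℕ → A) (l : ℕ) : A :=
  if l < p then s l else if l = p then x else if l = p + 1 then y else s (l - 2)

/-- The `i`-th face of a cochain, evaluated at a sequence. -/
def faceEval {n : ℕ} (i : ℕ) (f : HochschildCochain k A M n) (s : ℕ → A) : M :=
  (if i = 0 then s 0 else 1) • MulOpposite.op (if i = n + 1 then s n else 1) •
    seqEval f (mergeAt i s)

theorem seqEval_congr {n : ℕ} (f : HochschildCochain k A M n) {s t : ℕ → A}
    (h : ∀ l < n, s l = t l) : seqEval f s = seqEval f t :=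
  congrArg f (funext fun l => h l l.2)

/-- Indexing arguments by `ℕ` removes all casts between different `Fin n`. Entries past the arity
are never read, so the filler `0` is harmless. -/
theorem exists_seq {n : ℕ} (a : Fin n → A) : ∃ s : ℕ → A, a = fun l : Fin n => s l :=
  ⟨fun l => if h : l < n then a ⟨l, h⟩ else 0, by simp⟩

theorem cochain_ext_seq {n : ℕ} {f g : HochschildCochain k A M n}
    (h : ∀ s, seqEval f s = seqEval g s) : f = g := by
  ext a
  obtain ⟨s, rfl⟩ := exists_seq a
  exact h s

theorem seqEval_hochschildFace {n : ℕ} (i : Fin (n + 2)) (f : HochschildCochain k A M n)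
    (s : ℕ → A) : seqEval (hochschildFace i f) s = faceEval i.val f s := by
  rw [seqEval, hochschildFace_apply]
  rfl

theorem seqEval_hochschildD {n : ℕ} (f : HochschildCochain k A M n) (s : ℕ → A) :
    seqEval (hochschildD k A M n f) s =
      ∑ i ∈ Finset.range (n + 2), (-1 : k) ^ i • faceEval i f s := by
  rw [hochschildD_eq_sum, seqEval, Finset.sum_range, sum_apply]
  refine Finset.sum_congr rfl fun i _ => ?_
  rw [smul_apply, ← seqEval_hochschildFace, seqEval]

theorem insertNth_seq {n : ℕ} (p : Fin (n + 1)) (x : A) (s : ℕ → A) :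
    (p.insertNth x (fun l : Fin n => s l) : Fin (n + 1) → A) = fun l : Fin (n + 1) =>
      (if l.val < p.val then s l else if l.val = p.val then x else s (l.val - 1) : A) := by
  ext l
  refine Fin.succAboveCases p ?_ (fun j => ?_) l
  · simp
  · rw [Fin.insertNth_apply_succAbove]
    unfold Fin.succAbove
    split_ifs <;> simp_all [Fin.lt_def] <;> grind

variable (k) in
/-- Elements `xᵢ, yᵢ` of `E` such that `∑ xᵢ ⊗ yᵢ` is a separability idempotent of `E`. -/
structure SeparabilityData (E : Subalgebra k A) (ι : Type) [Fintype ι] where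
  x : ι → A
  y : ι → A
  x_mem : ∀ i, x i ∈ E
  y_mem : ∀ i, y i ∈ E
  sum_mul : ∑ i, x i * y i = 1
  comm : ∀ e ∈ E, ∃ c : ι → ι → k, (∀ i, e * x i = ∑ j, c i j • x j) ∧
    ∀ j, y j * e = ∑ i, c i j • y i

/-- The cochain `(a₀, …, aₙ₋₁) ↦ (∂ₚ f) (a₀, …, aₚ₋₁, u, v, aₚ, …, aₙ₋₁)`. -/
def insertFace {n : ℕ} (p : Fin (n + 1)) (f : HochschildCochain k A M (n + 1)) :
    A →ₗ[k] A →ₗ[k] HochschildCochain k A M n :=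
  LinearMap.mk₂ k (fun u v => MultilinearMap.curryMid p
      (MultilinearMap.curryMid p.castSucc (hochschildFace p.castSucc.castSucc f) u) v)
    (fun _ _ _ => by rw [map_add]; rfl) (fun _ _ _ => by rw [map_smul]; rfl)
    (fun _ _ _ => map_add _ _ _) (fun _ _ _ => map_smul _ _ _)

theorem seqEval_insertFace {n : ℕ} (p : Fin (n + 1)) (f : HochschildCochain k A M (n + 1))
    (u v : A) (s : ℕ → A) :
    seqEval (insertFace p f u v) s = faceEval p f (insertTwo p u v s) := by
  rw [← Fin.val_castSucc p, ← Fin.val_castSucc p.castSucc, ← seqEval_hochschildFace]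
  -- `v` goes in at position `p` first; inserting `u` at the same position then pushes `v` to `p +
  -- 1`.
  change hochschildFace _ f (p.castSucc.insertNth u (p.insertNth v fun l : Fin n => s l)) = _
  rw [insertNth_seq, insertNth_seq p.castSucc u
    (fun l => if l < p.val then s l else if l = p.val then v else s (l - 1)), seqEval]
  congr 1
  ext l
  simp only [insertTwo, Fin.val_castSucc]
  grind

variable {E : Subalgebra k A} {ι : Type} [Fintype ι] (D : SeparabilityData k E ι)

/-- The homotopy `(a₀, …, aₙ₋₁) ↦ ∑ f (a₀, …, aₚ₋₁ xᵢ, yᵢ, aₚ, …, aₙ₋₁)`. -/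
def SeparabilityData.homotopy {n : ℕ} (p : Fin (n + 1)) (f : HochschildCochain k A M (n + 1)) :
    HochschildCochain k A M n :=
  ∑ i, insertFace p f (D.x i) (D.y i)

theorem SeparabilityData.seqEval_homotopy {n : ℕ} (p : Fin (n + 1))
    (f : HochschildCochain k A M (n + 1)) (s : ℕ → A) :
    seqEval (D.homotopy p f) s = ∑ i, faceEval p f (insertTwo p (D.x i) (D.y i) s) := by
  simp only [← seqEval_insertFace, seqEval, homotopy, sum_apply]

/-- `∑ (e xᵢ) ⊗ yᵢ = ∑ xᵢ ⊗ (yᵢ e)`. -/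
theorem SeparabilityData.sum_comm {e : A} (he : e ∈ E) {N : Type*} [AddCommGroup N] [Module k N]
    (b : A →ₗ[k] A →ₗ[k] N) :
    ∑ i, b (e * D.x i) (D.y i) = ∑ i, b (D.x i) (D.y i * e) := by
  obtain ⟨c, hx, hy⟩ := D.comm e he
  simp only [hx, hy, map_sum, map_smul, LinearMap.sum_apply, LinearMap.smul_apply]
  exact Finset.sum_comm

end Normalization

/-! ### Normalized and relative cochains -/

section Normalization

variable {k : Type u} [Field k] {A : Type v} [Ring A] [Algebra k A]
variable {M : Type w} [AddCommGroup M] [Module k M] [Module A M] [Module Aᵐᵒᵖ M]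
  [IsScalarTower k A M] [IsScalarTower k Aᵐᵒᵖ M] [SMulCommClass A Aᵐᵒᵖ M]

/-- Used with `G i` the faces of a normalized cochain: if the argument `j` lies in `E`, every face
except `j` and `j + 1` leaves it intact as a separate argument and so vanishes. -/
theorem sum_alternating_pair {G : ℕ → M} {N j : ℕ} (hj : j + 1 < N)
    (h : ∀ i < N, i ≠ j → i ≠ j + 1 → G i = 0) :
    ∑ i ∈ Finset.range N, (-1 : k) ^ i • G i = (-1 : k) ^ j • (G j - G (j + 1)) := by
  rw [Finset.sum_eq_add_of_mem j (j + 1) (by simp; omega) (by simpa) (by omega)]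
  · rw [pow_succ, smul_sub]
    simp [sub_eq_add_neg]
  · intro i hi hij
    rw [h i (by simpa using hi) hij.1 hij.2, smul_zero]

theorem seqEval_eq_zero {n j : ℕ} (hj : j < n) (f : HochschildCochain k A M n) {s : ℕ → A}
    (h : s j = 0) : seqEval f s = 0 :=
  f.map_coord_zero ⟨j, hj⟩ h

variable (E : Subalgebra k A)

/-- The cochain `f` vanishes when its `j`-th argument lies in `E`. -/
def VanishesAt {n : ℕ} (j : ℕ) (f : HochschildCochain k A M n) : Prop :=
  ∀ s : ℕ → A, s j ∈ E → seqEval f s = 0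

variable {E}

theorem VanishesAt.faceEval {n j i : ℕ} {f : HochschildCochain k A M n} (h : VanishesAt E j f)
    {s : ℕ → A} (hs : mergeAt i s j ∈ E) : faceEval i f s = 0 := by
  rw [_root_.faceEval, h _ hs, smul_zero, smul_zero]

/-- A normalized cochain with normalized coboundary is `E`-relative. -/
theorem faceEval_eq_of_vanishesAt {n j : ℕ} (hj : j ≤ n) {f : HochschildCochain k A M n}
    (hl : ∀ i, i + 1 = j → VanishesAt E i f) (hf : j < n → VanishesAt E j f)
    (hdf : VanishesAt E j (hochschildD k A M n f)) {s : ℕ → A} (hs : s j ∈ E) :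
    faceEval j f s = faceEval (j + 1) f s := by
  have h := hdf s hs
  rw [seqEval_hochschildD, sum_alternating_pair (j := j) (by omega)] at h
  · rw [← sub_eq_zero]
    exact (smul_eq_zero_iff_right (pow_ne_zero _ (by simp))).1 h
  · intro i hi h1 h2
    rcases lt_or_gt_of_ne h1 with h3 | h3
    -- A face to the left shifts the entry `j` to position `j - 1`; one to the right, treated next,
    -- leaves it in place.
    · refine (hl (j - 1) (by omega)).faceEval ?_
      simp only [mergeAt]
      grind
    · refine (hf (by omega)).faceEval ?_
      simp only [mergeAt]
      grind

/-- A relative normalized cochain has normalized coboundary. -/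
theorem vanishesAt_hochschildD {n j : ℕ} (hj : j ≤ n) {f : HochschildCochain k A M n}
    (hl : ∀ i, i + 1 = j → VanishesAt E i f) (hf : j < n → VanishesAt E j f)
    (h : ∀ s : ℕ → A, s j ∈ E → faceEval j f s = faceEval (j + 1) f s) :
    VanishesAt E j (hochschildD k A M n f) := by
  intro s hs
  rw [seqEval_hochschildD, sum_alternating_pair (j := j) (by omega), h s hs, sub_self, smul_zero]
  intro i hi h1 h2
  rcases lt_or_gt_of_ne h1 with h3 | h3
  · refine (hl (j - 1) (by omega)).faceEval ?_
    simp only [mergeAt]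
    grind
  · refine (hf (by omega)).faceEval ?_
    simp only [mergeAt]
    grind

/-- Insert an entry at the position `j`. -/
def insertOne (j : ℕ) (e : A) (s : ℕ → A) (l : ℕ) : A :=
  if l < j then s l else if l = j then e else s (l - 1)

theorem insertOne_self (j : ℕ) (e : A) (s : ℕ → A) : insertOne j e s j = e := by
  simp [insertOne]

theorem faceEval_zero_insertOne {n : ℕ} (f : HochschildCochain k A M n) (e : A) (s : ℕ → A) :
    faceEval 0 f (insertOne 0 e s) = e • seqEval f s := by
  simp only [faceEval, insertOne_self, if_true]
  rw [if_neg (by omega), MulOpposite.op_one, one_smul]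
  exact congrArg _ (seqEval_congr _ fun l _ => by simp [mergeAt, insertOne])

theorem faceEval_last_insertOne {n : ℕ} (f : HochschildCochain k A M n) (e : A) (s : ℕ → A) :
    faceEval (n + 1) f (insertOne n e s) = MulOpposite.op e • seqEval f s := by
  simp only [faceEval, insertOne_self, if_true]
  rw [if_neg (by omega), one_smul]
  refine congrArg _ (seqEval_congr _ fun l hl => ?_)
  simp only [mergeAt, insertOne]
  grind

theorem faceEval_insertOne_left {n j : ℕ} (hj : j < n) (f : HochschildCochain k A M n) (e : A)
    (s : ℕ → A) : faceEval (j + 1) f (insertOne (j + 1) e s) =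
      seqEval f (Function.update s j (s j * e)) := by
  simp only [faceEval]
  rw [if_neg (by omega), one_smul, if_neg (by omega), MulOpposite.op_one, one_smul]
  refine seqEval_congr _ fun l hl => ?_
  simp only [mergeAt, insertOne, Function.update_apply]
  grind

theorem faceEval_insertOne_right {n j : ℕ} (hj : j < n) (f : HochschildCochain k A M n) (e : A)
    (s : ℕ → A) : faceEval (j + 1) f (insertOne j e s) =
      seqEval f (Function.update s j (e * s j)) := by
  simp only [faceEval]
  rw [if_neg (by omega), one_smul, if_neg (by omega), MulOpposite.op_one, one_smul]
  refine seqEval_congr _ fun l hl => ?_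
  simp only [mergeAt, insertOne, Function.update_apply]
  grind

variable (E) in
/-- `E`-relative cochains. -/
def IsRelative {n : ℕ} (f : HochschildCochain k A M n) : Prop :=
  ∀ j ≤ n, ∀ s : ℕ → A, s j ∈ E → faceEval j f s = faceEval (j + 1) f s

theorem IsRelative.smul_seqEval {n : ℕ} (hn : 0 < n) {f : HochschildCochain k A M n}
    (h : IsRelative E f) {e : A} (he : e ∈ E) (s : ℕ → A) :
    e • seqEval f s = seqEval f (Function.update s 0 (e * s 0)) := by
  rw [← faceEval_zero_insertOne, ← faceEval_insertOne_right hn]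
  exact h 0 (Nat.zero_le _) _ (by rwa [insertOne_self])

theorem IsRelative.op_smul_seqEval {n : ℕ} {f : HochschildCochain k A M (n + 1)}
    (h : IsRelative E f) {e : A} (he : e ∈ E) (s : ℕ → A) :
    MulOpposite.op e • seqEval f s = seqEval f (Function.update s n (s n * e)) := by
  rw [← faceEval_last_insertOne, ← faceEval_insertOne_left (Nat.lt_succ_self n)]
  exact (h (n + 1) le_rfl _ (by rwa [insertOne_self])).symm

theorem IsRelative.seqEval_update {n j : ℕ} (hj : j + 1 < n) {f : HochschildCochain k A M n}
    (h : IsRelative E f) {e : A} (he : e ∈ E) (s : ℕ → A) :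
    seqEval f (Function.update s j (s j * e)) =
      seqEval f (Function.update s (j + 1) (e * s (j + 1))) := by
  rw [← faceEval_insertOne_left (by omega), ← faceEval_insertOne_right hj]
  exact h (j + 1) hj.le _ (by rwa [insertOne_self])

theorem IsRelative.smul_eq_op_smul {f : HochschildCochain k A M 0}
    (h : IsRelative E f) {e : A} (he : e ∈ E) (s : ℕ → A) :
    e • seqEval f s = MulOpposite.op e • seqEval f s := by
  rw [← faceEval_last_insertOne, ← faceEval_zero_insertOne]
  exact h 0 le_rfl _ (by rwa [insertOne_self])

/-- Every sequence arises by inserting its own `j`-th entry, so equality of the faces `j` and `j +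
1` says that this entry may pass from one neighbour to the other. At the two ends the neighbour is
the coefficient bimodule; in degree zero both neighbours are. -/
theorem isRelative_of_seqEval {n : ℕ} {f : HochschildCochain k A M n}
    (h0 : n = 0 → ∀ e ∈ E, ∀ s, e • seqEval f s = MulOpposite.op e • seqEval f s)
    (hl : 0 < n → ∀ e ∈ E, ∀ s,
      e • seqEval f s = seqEval f (Function.update s 0 (e * s 0)))
    (hm : ∀ j, j + 1 < n → ∀ e ∈ E, ∀ s, seqEval f (Function.update s j (s j * e)) =
      seqEval f (Function.update s (j + 1) (e * s (j + 1))))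
    (hr : ∀ j, j + 1 = n → ∀ e ∈ E, ∀ s,
      MulOpposite.op e • seqEval f s = seqEval f (Function.update s j (s j * e))) :
    IsRelative E f := by
  intro j hj s hs
  have e : s = insertOne j (s j) fun l => if l < j then s l else s (l + 1) := by
    ext l
    simp only [insertOne]
    grind
  generalize s j = a at hs e
  rw [e]
  rcases Nat.eq_zero_or_pos j with rfl | h
  · rw [faceEval_zero_insertOne]
    rcases Nat.eq_zero_or_pos n with rfl | hn
    · rw [faceEval_last_insertOne, h0 rfl _ hs]
    · rw [faceEval_insertOne_right hn, hl hn _ hs]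
  · obtain ⟨j, rfl⟩ : ∃ i, j = i + 1 := ⟨j - 1, by omega⟩
    rw [faceEval_insertOne_left (by omega)]
    rcases lt_or_eq_of_le hj with hj | rfl
    · rw [faceEval_insertOne_right hj, hm j hj _ hs]
    · rw [faceEval_last_insertOne, hr j rfl _ hs]

/-- A normalized cochain with normalized coboundary is relative. -/
theorem isRelative_of_vanishesAt {n : ℕ} {f : HochschildCochain k A M n}
    (hf : ∀ j < n, VanishesAt E j f) (hdf : ∀ j ≤ n, VanishesAt E j (hochschildD k A M n f)) :
    IsRelative E f := fun j hj _ hs =>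
  faceEval_eq_of_vanishesAt hj (fun i hi => hf i (by omega)) (hf j) (hdf j hj) hs

/-- A normalized relative cochain has normalized coboundary. -/
theorem IsRelative.vanishesAt_hochschildD {n : ℕ} {f : HochschildCochain k A M n}
    (hf : ∀ j < n, VanishesAt E j f) (h : IsRelative E f) {j : ℕ} (hj : j ≤ n) :
    VanishesAt E j (hochschildD k A M n f) :=
  _root_.vanishesAt_hochschildD hj (fun i hi => hf i (by omega)) (hf j) (h j hj)

/-- A simplicial identity: taking the face `i` before the insertion or after it gives the same, once
the insertion point is moved to `p + 1`. The scalars in front are the outer actions hidden in a face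
of the homotopy. -/
theorem faceEval_insertTwo_mergeAt_of_le {n p i : ℕ} (hi : i ≤ p) (hp : p ≤ n)
    (f : HochschildCochain k A M (n + 1)) (x y : A) (s : ℕ → A) :
    (if i = 0 then s 0 else 1) • MulOpposite.op (if i = n + 1 then s n else 1) •
        faceEval p f (insertTwo p x y (mergeAt i s)) =
      faceEval i f (mergeAt (p + 1) (insertTwo (p + 1) x y s)) := by
  have h1 : i ≠ n + 1 := by omega
  have h2 : p ≠ n + 2 := by omega
  have h3 : i ≠ n + 2 := by omega
  simp only [faceEval, h1, h2, h3, if_false, MulOpposite.op_one, one_smul, smul_smul, add_assoc,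
    Nat.reduceAdd]
  congr 1
  · simp only [mergeAt, insertTwo]
    grind
  · refine seqEval_congr _ fun l _ => ?_
    simp only [mergeAt, insertTwo]
    grind

/-- The complementary simplicial identity: to the right of the insertion, the face `i` becomes the
face `i + 1`. -/
theorem faceEval_insertTwo_mergeAt_of_gt {n p i : ℕ} (hi : p < i) (hin : i ≤ n + 1)
    (f : HochschildCochain k A M (n + 1)) (x y : A) (s : ℕ → A) :
    (if i = 0 then s 0 else 1) • MulOpposite.op (if i = n + 1 then s n else 1) •
        faceEval p f (insertTwo p x y (mergeAt i s)) =
      (if p = 0 then x else 1) • faceEval (i + 1) f (mergeAt p (insertTwo p x y s)) := by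
  have h1 : i ≠ 0 := by omega
  have h2 : p ≠ n + 2 := by omega
  simp only [faceEval, h1, h2, if_false, MulOpposite.op_one, one_smul, add_assoc, Nat.reduceAdd,
    Nat.add_eq_zero_iff, one_ne_zero, and_false]
  rw [← smul_comm]
  congr 1
  · simp only [insertTwo]
    grind
  congr 1
  · simp only [mergeAt, insertTwo]
    grind
  · refine seqEval_congr _ fun l _ => ?_
    simp only [mergeAt, insertTwo]
    grind

/-- In the face `p` of the homotopy the entry `s p` multiplies `x` from the left.
`faceEval_succ_insertTwo` is the counterpart in which it multiplies `y` from the right;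
`SeparabilityData.sum_comm` identifies the two after summation. -/
theorem faceEval_insertTwo_mergeAt_self {n p : ℕ} (hp : p ≤ n)
    (f : HochschildCochain k A M (n + 1)) (x y : A) (s : ℕ → A) :
    (if p = 0 then s 0 else 1) • MulOpposite.op (if p = n + 1 then s n else 1) •
        faceEval p f (insertTwo p x y (mergeAt p s)) =
      faceEval p f (insertTwo p (s p * x) y fun l => if l < p then s l else s (l + 1)) := by
  have h1 : p ≠ n + 1 := by omega
  have h2 : p ≠ n + 2 := by omega
  simp only [faceEval, h1, h2, if_false, MulOpposite.op_one, one_smul, smul_smul, add_assoc,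
    Nat.reduceAdd]
  congr 1
  · simp only [mergeAt, insertTwo]
    grind
  · refine seqEval_congr _ fun l _ => ?_
    simp only [mergeAt, insertTwo]
    grind [mul_assoc]

theorem faceEval_succ_insertTwo {n p : ℕ} (hp : p ≤ n)
    (f : HochschildCochain k A M (n + 1)) (x y : A) (s : ℕ → A) :
    (if p = 0 then x else 1) • faceEval (p + 1) f (mergeAt p (insertTwo p x y s)) =
      faceEval p f (insertTwo p x (y * s p) fun l => if l < p then s l else s (l + 1)) := by
  have h1 : p + 1 ≠ n + 2 := by omega
  have h2 : p ≠ n + 2 := by omega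
  simp only [faceEval, h1, h2, if_false, MulOpposite.op_one, one_smul, smul_smul, add_assoc,
    Nat.reduceAdd]
  congr 1
  · simp only [mergeAt, insertTwo]
    grind
  · refine seqEval_congr _ fun l _ => ?_
    simp only [mergeAt, insertTwo]
    grind [mul_assoc]

variable {ι : Type} [Fintype ι] (D : SeparabilityData k E ι)

/-- The face `p` brings each `x r` next to its `y r`, and `∑ xᵣ yᵣ = 1`. For `p = 0` the product
acts on the value; for `p > 0` it multiplies the entry `p - 1`. -/
theorem SeparabilityData.sum_faceEval_self {n p : ℕ} (hp : p ≤ n)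
    (f : HochschildCochain k A M (n + 1)) (s : ℕ → A) :
    ∑ r, (if p = 0 then D.x r else 1) •
      faceEval p f (mergeAt p (insertTwo p (D.x r) (D.y r) s)) = seqEval f s := by
  have h2 : p ≠ n + 2 := by omega
  simp only [faceEval, h2, if_false, MulOpposite.op_one, one_smul, smul_smul, add_assoc,
    Nat.reduceAdd]
  rcases Nat.eq_zero_or_pos p with rfl | h0
  · have (r : ι) : seqEval f (mergeAt 0 (mergeAt 0 (insertTwo 0 (D.x r) (D.y r) s))) =
        seqEval f s := by
      refine seqEval_congr _ fun l _ => ?_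
      simp [mergeAt, insertTwo]
    simp only [this, ← Finset.sum_smul]
    simp [mergeAt, insertTwo, D.sum_mul]
  · have (r : ι) : seqEval f (mergeAt p (mergeAt p (insertTwo p (D.x r) (D.y r) s))) =
        f (Function.update (fun l : Fin (n + 1) => s l) ⟨p - 1, by omega⟩
          (s (p - 1) * (D.x r * D.y r))) := by
      refine congrArg f (funext fun l => ?_)
      simp only [mergeAt, insertTwo, Function.update_apply, Fin.ext_iff]
      grind [mul_assoc]
    simp only [this, h0.ne', if_false, one_smul, mul_one]
    rw [← MultilinearMap.map_update_sum, ← Finset.mul_sum, D.sum_mul, mul_one]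
    exact congrArg f (Function.update_eq_self _ _)

theorem SeparabilityData.faceEval_homotopy {n : ℕ} (p : Fin (n + 1)) (i : ℕ)
    (f : HochschildCochain k A M (n + 1)) (s : ℕ → A) :
    faceEval i (D.homotopy p f) s =
      ∑ r, (if i = 0 then s 0 else 1) • MulOpposite.op (if i = n + 1 then s n else 1) •
        faceEval p f (insertTwo p (D.x r) (D.y r) (mergeAt i s)) := by
  rw [faceEval, D.seqEval_homotopy, Finset.smul_sum, Finset.smul_sum]

/-- One step of the normalization. -/
theorem SeparabilityData.vanishesAt_sub {n : ℕ} (p : Fin (n + 1))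
    (f : HochschildCochain k A M (n + 1)) (hf : ∀ j < p.val, VanishesAt E j f)
    (hdf : ∀ j ≤ p.val, VanishesAt E j (hochschildD k A M (n + 1) f)) (j : ℕ) (hj : j ≤ p.val) :
    VanishesAt E j (f - hochschildD k A M n ((-1 : k) ^ p.val • D.homotopy p f)) := by
  intro s hs
  have hp : p.val ≤ n := by omega
  have hsub : seqEval (f - hochschildD k A M n ((-1 : k) ^ p.val • D.homotopy p f)) s =
      seqEval f s - (-1 : k) ^ p.val • seqEval (hochschildD k A M n (D.homotopy p f)) s := by
    rw [map_smul]
    simp [seqEval]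
  rw [hsub]
  rcases lt_or_eq_of_le hj with hj | rfl
  -- Arguments already normalized stay normalized: the faces `j` and `j + 1` of the homotopy agree
  -- because those of `f` do, and the other faces vanish.
  · rw [hf j hj s hs, seqEval_hochschildD, sum_alternating_pair (j := j) (by omega)]
    · simp only [D.faceEval_homotopy]
      rw [← Finset.sum_sub_distrib, Finset.sum_eq_zero]
      · simp
      intro r _
      rw [faceEval_insertTwo_mergeAt_of_le (by omega) hp,
        faceEval_insertTwo_mergeAt_of_le (by omega) hp, sub_eq_zero]
      refine faceEval_eq_of_vanishesAt (by omega) (fun i hi => hf i (by omega))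
        (fun _ => hf j hj) (hdf j hj.le) ?_
      simp only [mergeAt, insertTwo]
      grind
    · have hT : ∀ l < p.val, VanishesAt E l (D.homotopy p f) := by
        intro l hl t ht
        rw [D.seqEval_homotopy]
        refine Finset.sum_eq_zero fun r _ => (hf l hl).faceEval ?_
        have := E.mul_mem ht (D.x_mem r)
        simp only [mergeAt, insertTwo]
        grind
      intro i hi h1 h2
      rcases lt_or_gt_of_ne h1 with h3 | h3
      · refine (hT (j - 1) (by omega)).faceEval ?_
        simp only [mergeAt]
        grind
      · refine (hT j hj).faceEval ?_
        simp only [mergeAt]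
        grind
  -- The new argument. `G` lists the faces of the homotopy; `H` lists the terms of the coboundary of
  -- `f` at the entries `…, s (p-1) * x r, y r, s p, …`. The alternating sum of `H` is zero since `y
  -- r` lies in `E` at position `p`, and `G i = H (i + 1)` for `i ≥ p`.
  · let G (i : ℕ) : M := faceEval i (D.homotopy p f) s
    let H (i : ℕ) : M := ∑ r, (if p.val = 0 then D.x r else 1) •
      faceEval i f (mergeAt p (insertTwo p (D.x r) (D.y r) s))
    have hH : ∑ i ∈ Finset.range (n + 3), (-1 : k) ^ i • H i = 0 := by
      simp only [H, Finset.smul_sum]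
      rw [Finset.sum_comm]
      refine Finset.sum_eq_zero fun r _ => ?_
      have h := hdf p le_rfl (mergeAt p (insertTwo p (D.x r) (D.y r) s)) (by
        simpa [mergeAt, insertTwo] using D.y_mem r)
      rw [seqEval_hochschildD] at h
      simp only [smul_comm ((-1 : k) ^ _)]
      rw [← Finset.smul_sum, h, smul_zero]
    have hH0 : ∀ i < p.val, H i = 0 := by
      intro i hi
      refine Finset.sum_eq_zero fun r _ => ?_
      rw [(hf (p - 1) (by omega)).faceEval, smul_zero]
      have := D.y_mem r
      simp only [mergeAt, insertTwo]
      grind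
    have hHp : H p = seqEval f s := D.sum_faceEval_self hp f s
    have hG0 : ∀ i < p.val, G i = 0 := by
      intro i hi
      simp only [G, D.faceEval_homotopy]
      refine Finset.sum_eq_zero fun r _ => ?_
      rw [(hf (p - 1) (by omega)).faceEval, smul_zero, smul_zero]
      have := E.mul_mem hs (D.x_mem r)
      simp only [mergeAt, insertTwo]
      grind
    have hGp : G p = H (p + 1) := by
      simp only [G, H, D.faceEval_homotopy, faceEval_insertTwo_mergeAt_self hp,
        faceEval_succ_insertTwo hp]
      simp only [← seqEval_insertFace]
      have := D.sum_comm hs (insertFace p f)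
      have := congrArg (fun g => seqEval g fun l => if l < p.val then s l else s (l + 1)) this
      simpa only [seqEval, sum_apply] using this
    have hG : ∀ i, p.val < i → i ≤ n + 1 → G i = H (i + 1) := by
      intro i hi hin
      simp only [G, H, D.faceEval_homotopy, faceEval_insertTwo_mergeAt_of_gt hi hin]
    have key : ∑ i ∈ Finset.range (n + 2), (-1 : k) ^ i • G i = (-1 : k) ^ p.val • H p := by
      rw [Finset.sum_range_succ'] at hH
      have e : ∑ i ∈ Finset.range (n + 2), (-1 : k) ^ i • G i =
          ∑ i ∈ Finset.range (n + 2), (-1 : k) ^ i • (G i - H (i + 1)) + H 0 := by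
        simp only [smul_sub, Finset.sum_sub_distrib]
        simp only [pow_succ, mul_neg, mul_one, neg_smul, Finset.sum_neg_distrib, pow_zero,
          one_smul] at hH
        rw [sub_add, eq_comm, sub_eq_self, sub_eq_zero, ← sub_eq_zero]
        exact neg_eq_zero.1 ((by abel : _ = _).trans hH)
      rw [e]
      rcases Nat.eq_zero_or_pos p.val with h0 | h0
      · rw [Finset.sum_eq_zero]
        · simp [h0]
        intro i hi
        rw [Finset.mem_range] at hi
        rcases Nat.eq_zero_or_pos i with rfl | hi0
        · rw [h0] at hGp
          simp [hGp]
        · rw [hG i (by omega) (by omega), sub_self, smul_zero]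
      -- After the shift `G i - H (i + 1)`, only `i = p - 1` survives, where `G` is zero and `H p`
      -- is the value of `f`. For `p = 0` that term is the split-off `H 0`.
      · rw [hH0 0 h0, add_zero, Finset.sum_eq_single_of_mem (p.val - 1) (by simp; omega)]
        · obtain ⟨q, hq⟩ : ∃ q, p.val = q + 1 := ⟨p - 1, by omega⟩
          rw [hG0 _ (by omega), hq]
          simp [pow_succ]
        intro i hi hip
        rw [Finset.mem_range] at hi
        rcases lt_trichotomy i p.val with h | h | h
        · rw [hG0 i h, hH0 (i + 1) (by omega), sub_self, smul_zero]
        · rw [h, hGp, sub_self, smul_zero]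
        · rw [hG i (by omega) (by omega), sub_self, smul_zero]
    rw [seqEval_hochschildD, key, hHp, smul_smul, ← mul_pow]
    simp

/-- A cochain whose coboundary is normalized relative to a separable subalgebra is cohomologous
to a normalized one. -/
theorem SeparabilityData.exists_vanishesAt (D : SeparabilityData k E ι) {n : ℕ}
    (f : HochschildCochain k A M (n + 1))
    (hdf : ∀ j < n + 1, VanishesAt E j (hochschildD k A M (n + 1) f)) :
    ∃ g, ∀ j < n + 1, VanishesAt E j (f - hochschildD k A M n g) := by
  -- Normalize from left to right. Subtracting a coboundary does not change the coboundary of `f`,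
  -- so the hypothesis persists through the induction.
  have main : ∀ p ≤ n + 1, ∃ g, ∀ j < p, VanishesAt E j (f - hochschildD k A M n g) := by
    intro p
    induction p with
    | zero => exact fun _ => ⟨0, by simp⟩
    | succ p ih =>
      intro hp
      obtain ⟨g, hg⟩ := ih (by omega)
      have := D.vanishesAt_sub ⟨p, by omega⟩ (f - hochschildD k A M n g) hg (by
        intro j hj
        rw [map_sub, hochschildD_hochschildD, sub_zero]
        exact hdf j (by simp at hj; omega))
      refine ⟨g + (-1 : k) ^ p • D.homotopy ⟨p, by omega⟩ (f - hochschildD k A M n g),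
        fun j hj => ?_⟩
      rw [map_add, ← sub_sub]
      exact this j (by simp; omega)
  exact main (n + 1) le_rfl

end Normalization

/-! ### Degree zero and criteria for the cohomology spaces -/

section Criteria

variable (k : Type u) [Field k] (A : Type v) [Ring A] [Algebra k A]

/-- `HH⁰` is the centre. -/
def HH.zeroEquiv : HH k A 0 ≃ₗ[k] Subalgebra.center k A :=
  Submodule.quotEquivOfEqBot _ (by
      simp [hochschildCoboundaries, Submodule.submoduleOf]) ≪≫ₗ
    ((MultilinearMap.constLinearEquivOfIsEmpty (R := k) (S := k) (M₁ := fun _ : Fin 0 => A)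
      (M₂ := A)).symm.submoduleMap (LinearMap.ker (hochschildD k A A 0))) ≪≫ₗ
    LinearEquiv.ofEq _ (Subalgebra.toSubmodule (Subalgebra.center k A)) (by
      ext a
      rw [Submodule.mem_map_equiv, LinearEquiv.symm_symm, LinearMap.mem_ker,
        Subalgebra.mem_toSubmodule, Subalgebra.mem_center_iff, MultilinearMap.ext_iff]
      have h (s : Fin 1 → A) : hochschildD k A A 0
          (MultilinearMap.constLinearEquivOfIsEmpty k k (fun _ => A) A a) s = s 0 * a - a * s 0 := by
        simp [hochschildD_apply, sub_eq_add_neg]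
      simp only [h, zero_apply, sub_eq_zero]
      exact ⟨fun h b => h fun _ => b, fun h s => h (s 0)⟩)

variable {k A}

theorem HH.subsingleton_of_exists {n : ℕ}
    (h : ∀ f : HochschildCochain k A A n, hochschildD k A A n f = 0 →
      f ∈ hochschildCoboundaries k A A n) : Subsingleton (HH k A n) := by
  have h0 (w : HH k A n) : w = 0 := by
    obtain ⟨f, rfl⟩ := Submodule.Quotient.mk_surjective _ w
    exact (Submodule.Quotient.mk_eq_zero _).2 (h f.1 f.2)
  exact ⟨fun a b => (h0 a).trans (h0 b).symm⟩

theorem HH.nonempty_equiv_of_generator {n : ℕ} (z : HochschildCochain k A A n)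
    (hz : hochschildD k A A n z = 0) (hz' : z ∉ hochschildCoboundaries k A A n)
    (h : ∀ f : HochschildCochain k A A n, hochschildD k A A n f = 0 →
      ∃ c : k, f - c • z ∈ hochschildCoboundaries k A A n) : Nonempty (HH k A n ≃ₗ[k] k) := by
  have h1 : Module.finrank k (HH k A n) = 1 := by
    rw [finrank_eq_one_iff']
    refine ⟨Submodule.Quotient.mk ⟨z, hz⟩, ?_, fun w => ?_⟩
    · rw [Ne, Submodule.Quotient.mk_eq_zero]
      exact hz'
    · obtain ⟨⟨f, hf⟩, rfl⟩ := Submodule.Quotient.mk_surjective _ w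
      obtain ⟨c, hc⟩ := h f hf
      refine ⟨c, ?_⟩
      rw [← Submodule.Quotient.mk_smul, eq_comm, Submodule.Quotient.eq]
      exact hc
  have := Module.finite_of_finrank_pos (by rw [h1]; exact one_pos : 0 < Module.finrank k (HH k A n))
  exact ⟨LinearEquiv.ofFinrankEq _ _ (by rw [h1, Module.finrank_self])⟩

theorem hochschildDim_eq_top (h : ∀ n, Nontrivial (HH k A n)) : hochschildDim k A = ⊤ := by
  refine ENat.eq_top_iff_forall_ge.2 fun n => le_sSup ?_
  exact ⟨n, A, inferInstance, inferInstance, inferInstance, inferInstance, inferInstance,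
    inferInstance, inferInstance, h n, rfl⟩

/-- A separable algebra has no higher Hochschild cohomology. -/
theorem SeparabilityData.subsingleton_HH {ι : Type} [Fintype ι]
    (D : SeparabilityData k (⊤ : Subalgebra k A) ι) {n : ℕ} (hn : 1 ≤ n) :
    Subsingleton (HH k A n) := by
  obtain ⟨n, rfl⟩ : ∃ m, n = m + 1 := ⟨n - 1, by omega⟩
  refine HH.subsingleton_of_exists fun f hf => ?_
  obtain ⟨g, hg⟩ := D.exists_vanishesAt f fun j _ s _ => by rw [hf]; rfl
  refine ⟨g, (sub_eq_zero.1 (cochain_ext_seq fun s => ?_)).symm⟩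
  -- With `E = ⊤` every argument lies in `E`, so vanishing at position `0` alone makes the cochain
  -- zero.
  rw [hg 0 (Nat.succ_pos _) s Algebra.mem_top]
  rfl

end Criteria

/-! ### Separable subalgebras spanned by orthogonal idempotents -/

section Idempotents

variable {k : Type u} [Field k] {A : Type v} [Ring A] [Algebra k A] {V : Type} [Fintype V]
variable {e : V → A}

theorem CompleteOrthogonalIdempotents.sum_smul_mul (h : CompleteOrthogonalIdempotents e)
    (c : V → k) (j : V) : (∑ i, c i • e i) * e j = c j • e j := by
  classical
  rw [Finset.sum_mul, Finset.sum_eq_single j]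
  · rw [smul_mul_assoc, h.idem j]
  · intro i _ hij
    rw [smul_mul_assoc, h.ortho hij, smul_zero]
  · simp

theorem CompleteOrthogonalIdempotents.mul_sum_smul (h : CompleteOrthogonalIdempotents e)
    (c : V → k) (j : V) : e j * (∑ i, c i • e i) = c j • e j := by
  classical
  rw [Finset.mul_sum, Finset.sum_eq_single j]
  · rw [mul_smul_comm, h.idem j]
  · intro i _ hij
    rw [mul_smul_comm, h.ortho hij.symm, smul_zero]
  · simp

variable (k)

/-- The subalgebra spanned by a complete family of orthogonal idempotents. -/
def CompleteOrthogonalIdempotents.subalgebra (h : CompleteOrthogonalIdempotents e) :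
    Subalgebra k A where
  carrier := Set.range fun c : V → k => ∑ i, c i • e i
  mul_mem' := by
    rintro _ _ ⟨c, rfl⟩ ⟨d, rfl⟩
    refine ⟨fun i => d i * c i, ?_⟩
    change _ = _ * ∑ i, d i • e i
    simp only [Finset.mul_sum, mul_smul_comm, h.sum_smul_mul, smul_smul]
  add_mem' := by
    rintro _ _ ⟨c, rfl⟩ ⟨d, rfl⟩
    exact ⟨c + d, by simp [add_smul, Finset.sum_add_distrib]⟩
  algebraMap_mem' r := ⟨fun _ => r, by
    change ∑ i, r • e i = _
    rw [← Finset.smul_sum, h.complete, Algebra.algebraMap_eq_smul_one]⟩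

theorem CompleteOrthogonalIdempotents.self_mem (h : CompleteOrthogonalIdempotents e) (i : V) :
    e i ∈ h.subalgebra k := by
  classical
  exact ⟨Pi.single i 1, by simp [Pi.single_apply]⟩

/-- The span of a complete family of orthogonal idempotents is separable. -/
def CompleteOrthogonalIdempotents.separabilityData (h : CompleteOrthogonalIdempotents e) :
    SeparabilityData k (h.subalgebra k) V where
  x := e
  y := e
  x_mem := h.self_mem k
  y_mem := h.self_mem k
  sum_mul := by simp only [(h.idem _).eq, h.complete]
  comm := by
    classical
    rintro _ ⟨c, rfl⟩
    refine ⟨fun i j => if i = j then c i else 0, fun i => ?_, fun j => ?_⟩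
    · simp [h.sum_smul_mul]
    · simp [h.mul_sum_smul]

end Idempotents

/-! ### Products of copies of the field, and matrix algebras -/

section Separable

variable (k : Type u) [Field k]

theorem HH_pi (V : Type) [Fintype V] :
    Nonempty (HH k (V → k) 0 ≃ₗ[k] (V → k)) ∧
      ∀ n : ℕ, 1 ≤ n → Subsingleton (HH k (V → k) n) := by
  classical
  refine ⟨⟨HH.zeroEquiv k (V → k) ≪≫ₗ LinearEquiv.ofEq
    (Subalgebra.toSubmodule (Subalgebra.center k (V → k))) ⊤ (by
    rw [Subalgebra.center_eq_top]; rfl) ≪≫ₗ Submodule.topEquiv⟩, fun n hn => ?_⟩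
  have h := CompleteOrthogonalIdempotents.single (fun _ : V => k)
  have htop : h.subalgebra k = ⊤ := by
    refine eq_top_iff.2 fun a _ => ⟨a, ?_⟩
    ext j
    simp [Pi.single_apply]
  have D := h.separabilityData k
  rw [htop] at D
  exact D.subsingleton_HH hn

/-- The separability idempotent `∑ Eᵢ₀ ⊗ E₀ᵢ` of a matrix algebra. -/
def Matrix.separabilityData (V : Type) [Fintype V] [DecidableEq V] (o : V) :
    SeparabilityData k (⊤ : Subalgebra k (Matrix V V k)) V where
  x i := Matrix.single i o 1
  y i := Matrix.single o i 1
  x_mem _ := Algebra.mem_top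
  y_mem _ := Algebra.mem_top
  sum_mul := by
    ext a b
    simp [Matrix.sum_apply, Matrix.single_apply, Matrix.one_apply, ite_and]
  comm e _ := by
    refine ⟨fun i j => e j i, fun i => ?_, fun j => ?_⟩
    · ext a b
      by_cases hb : o = b <;> simp [Matrix.sum_apply, Matrix.mul_apply, Matrix.single_apply, hb]
    · ext a b
      by_cases ha : o = a <;> simp [Matrix.sum_apply, Matrix.mul_apply, Matrix.single_apply, ha]

theorem HH_matrix (V : Type) [Fintype V] [DecidableEq V] [Nonempty V] :
    Nonempty (HH k (Matrix V V k) 0 ≃ₗ[k] k) ∧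
      ∀ n : ℕ, 1 ≤ n → Subsingleton (HH k (Matrix V V k) n) := by
  have o : V := Classical.arbitrary V
  refine ⟨⟨HH.zeroEquiv k _ ≪≫ₗ LinearEquiv.ofEq
    (Subalgebra.toSubmodule (Subalgebra.center k (Matrix V V k))) (Subalgebra.toSubmodule ⊥) (by
    rw [Algebra.IsCentral.center_eq_bot]) ≪≫ₗ (Algebra.botEquiv k _).toLinearEquiv⟩, fun n hn => ?_⟩
  exact (Matrix.separabilityData k V o).subsingleton_HH hn

end Separable

/-! ### Path algebras, and the quiver with one arrow and an isolated point -/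

section PathAlgebra

namespace PathAlgebra

variable (k : Type u) [Field k] {V : Type v} [Quiver.{w} V]

/-- The paths form a basis of the path algebra. -/
def basis : Module.Basis (QuiverPath V) k (PathAlgebra k V) :=
  Module.Basis.ofRepr (LinearEquiv.refl k _)

/-- The coefficient of a path. -/
def coeff (p : QuiverPath V) : PathAlgebra k V →ₗ[k] k := Finsupp.lapply p

theorem coeff_of_self (p : QuiverPath V) : coeff k p (of k p) = 1 := Finsupp.single_eq_same

theorem coeff_of_ne {p q : QuiverPath V} (h : q ≠ p) : coeff k p (of k q) = 0 :=
  Finsupp.single_eq_of_ne h.symm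

variable [DecidableEq V] [Fintype V]

theorem of_mul_of (p q : QuiverPath V) : of k p * of k q = pathMul k p q := mulMap_of k p q

/-- The idempotent of a vertex. -/
def vertex (v : V) : PathAlgebra k V := of k ⟨v, v, Quiver.Path.nil⟩

theorem vertex_mul_of (v : V) (p : QuiverPath V) :
    vertex k v * of k p = if p.2.1 = v then of k p else 0 := by
  obtain ⟨a, b, p⟩ := p
  rw [vertex, of_mul_of, pathMul]
  by_cases h : b = v
  · subst h
    simp
  · rw [dif_neg h, if_neg h]

theorem of_mul_vertex (v : V) (p : QuiverPath V) :
    of k p * vertex k v = if v = p.1 then of k p else 0 := by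
  obtain ⟨a, b, p⟩ := p
  rw [vertex, of_mul_of, pathMul]
  by_cases h : v = a
  · subst h
    simp
  · rw [dif_neg h, if_neg h]

theorem completeOrthogonalIdempotents :
    CompleteOrthogonalIdempotents (vertex k : V → PathAlgebra k V) where
  idem v := by
    rw [IsIdempotentElem]
    exact (vertex_mul_of k v _).trans (if_pos rfl)
  ortho v w h := by
    exact (vertex_mul_of k v _).trans (if_neg h.symm)
  complete := rfl

end PathAlgebra

namespace ArrowAndPoint

open PathAlgebra

/-- The path given by the only arrow. -/
def arrowPath : QuiverPath ArrowAndPoint := ⟨source, target, Quiver.Hom.toPath Arrow.arrow⟩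

/-- No arrow ends at `source`, so the arrow cannot be preceded by another one. -/
theorem eq_nil_or_eq_arrowPath (p : QuiverPath ArrowAndPoint) :
    (∃ v, p = ⟨v, v, Quiver.Path.nil⟩) ∨ p = arrowPath := by
  obtain ⟨a, b, p⟩ := p
  cases p with
  | nil => exact Or.inl ⟨a, rfl⟩
  | cons p e =>
    change Arrow _ _ at e
    cases e
    cases p with
    | nil => exact Or.inr rfl
    | cons p e =>
      change Arrow _ _ at e
      cases e

theorem nil_ne_arrowPath (v : ArrowAndPoint) :
    (⟨v, v, Quiver.Path.nil⟩ : QuiverPath _) ≠ arrowPath := by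
  intro h
  have h1 := congrArg Sigma.fst h
  have h2 := congrArg (fun p : QuiverPath ArrowAndPoint => p.2.1) h
  change v = source at h1
  change v = target at h2
  rw [h1] at h2
  cases h2

variable (k : Type u) [Field k]

/-- The basis element of the only arrow. -/
def arrow : PathAlgebra k ArrowAndPoint := of k arrowPath

theorem vertex_mul_arrow (v : ArrowAndPoint) :
    vertex k v * arrow k = if v = target then arrow k else 0 := by
  rw [arrow, vertex_mul_of]
  exact if_congr eq_comm rfl rfl

theorem arrow_mul_vertex (v : ArrowAndPoint) :
    arrow k * vertex k v = if v = source then arrow k else 0 :=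
  of_mul_vertex k v arrowPath

theorem exists_eq (z : PathAlgebra k ArrowAndPoint) :
    ∃ (c : ArrowAndPoint → k) (d : k), z = ∑ v, c v • vertex k v + d • arrow k := by
  induction z using PathAlgebra.induction with
  | h0 => exact ⟨0, 0, by simp⟩
  | hadd x y hx hy =>
    obtain ⟨c, d, rfl⟩ := hx
    obtain ⟨c', d', rfl⟩ := hy
    refine ⟨c + c', d + d', ?_⟩
    simp only [Pi.add_apply, add_smul, Finset.sum_add_distrib]
    abel
  | hof r p =>
    rcases eq_nil_or_eq_arrowPath p with ⟨v, rfl⟩ | rfl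
    · refine ⟨Pi.single v r, 0, ?_⟩
      rw [Finset.sum_eq_single v]
      · simp [vertex]
      · intro w _ h
        simp [h]
      · simp
    · exact ⟨0, r, by simp [arrow]⟩

theorem coeff_eq (v : ArrowAndPoint) (c : ArrowAndPoint → k) (d : k) :
    coeff k ⟨v, v, Quiver.Path.nil⟩ (∑ v, c v • vertex k v + d • arrow k) = c v := by
  have h (w : ArrowAndPoint) : coeff k ⟨v, v, Quiver.Path.nil⟩ (vertex k w) =
      if w = v then 1 else 0 := by
    split_ifs with h
    · subst h
      exact coeff_of_self k _
    · exact coeff_of_ne k fun h' => h (congrArg Sigma.fst h')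
  simp [h, arrow, coeff_of_ne k (nil_ne_arrowPath v).symm]

theorem vertex_mul_eq (v : ArrowAndPoint) (c : ArrowAndPoint → k) (d : k) :
    vertex k v * (∑ v, c v • vertex k v + d • arrow k) =
      c v • vertex k v + if v = target then d • arrow k else 0 := by
  rw [mul_add, (completeOrthogonalIdempotents k).mul_sum_smul, mul_smul_comm, vertex_mul_arrow]
  simp

theorem mul_vertex_eq (v : ArrowAndPoint) (c : ArrowAndPoint → k) (d : k) :
    (∑ v, c v • vertex k v + d • arrow k) * vertex k v =
      c v • vertex k v + if v = source then d • arrow k else 0 := by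
  rw [add_mul, (completeOrthogonalIdempotents k).sum_smul_mul, smul_mul_assoc, arrow_mul_vertex]
  simp

theorem arrow_mul_arrow : arrow k * arrow k = 0 := by
  rw [arrow, of_mul_of, pathMul, dif_neg]
  exact nofun

theorem arrow_mul_eq (c : ArrowAndPoint → k) (d : k) :
    arrow k * (∑ v, c v • vertex k v + d • arrow k) = c source • arrow k := by
  simp [mul_add, Finset.mul_sum, arrow_mul_vertex, arrow_mul_arrow]

theorem mul_arrow_eq (c : ArrowAndPoint → k) (d : k) :
    (∑ v, c v • vertex k v + d • arrow k) * arrow k = c target • arrow k := by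
  simp [add_mul, Finset.sum_mul, vertex_mul_arrow, arrow_mul_arrow]

theorem sum_univ {N : Type*} [AddCommMonoid N] (g : ArrowAndPoint → N) :
    ∑ v, g v = g source + (g target + g point) := by
  change ∑ v ∈ {source, target, point}, g v = _
  simp

/-- Commuting with the target vertex kills the coefficient of the arrow; commuting with the arrow
equates the coefficients of its two ends. -/
theorem mem_center_iff (z : PathAlgebra k ArrowAndPoint) :
    z ∈ Subalgebra.center k (PathAlgebra k ArrowAndPoint) ↔
      ∃ a b : k, z = a • (vertex k source + vertex k target) + b • vertex k point := by
  rw [Subalgebra.mem_center_iff]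
  constructor
  · intro h
    obtain ⟨c, d, rfl⟩ := exists_eq k z
    have hd : d = 0 := by
      have := congrArg (coeff k arrowPath) (h (vertex k target))
      rw [vertex_mul_eq, mul_vertex_eq] at this
      simpa [arrow, coeff_of_self] using this
    have hc : c source = c target := by
      have := congrArg (coeff k arrowPath) (h (arrow k))
      rw [arrow_mul_eq, mul_arrow_eq] at this
      simpa [arrow, coeff_of_self] using this
    refine ⟨c target, c point, ?_⟩
    rw [hd, sum_univ, hc]
    module
  · rintro ⟨a, b, rfl⟩ z
    have e : a • (vertex k source + vertex k target) + b • vertex k point =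
        ∑ v, (fun v => if v = point then b else a) v • vertex k v + (0 : k) • arrow k := by
      rw [sum_univ]
      simp [add_assoc]
    obtain ⟨c, d, rfl⟩ := exists_eq k z
    rw [e]
    simp only [add_mul _ (d • arrow k), mul_add _ _ (d • arrow k), Finset.sum_mul (s := Finset.univ)
      (f := fun v => c v • vertex k v),
      Finset.mul_sum (s := Finset.univ) (f := fun v => c v • vertex k v), smul_mul_assoc,
      mul_smul_comm, vertex_mul_eq, mul_vertex_eq, arrow_mul_eq, mul_arrow_eq]
    simp

/-- The centre of the path algebra of the quiver with three vertices and one arrow. -/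
theorem nonempty_center_equiv : Nonempty
    (Subalgebra.center k (PathAlgebra k ArrowAndPoint) ≃ₗ[k] (Fin 2 → k)) := by
  let Φ : (Fin 2 → k) →ₗ[k] PathAlgebra k ArrowAndPoint :=
    (LinearMap.proj 0).smulRight (vertex k source + vertex k target) +
      (LinearMap.proj 1).smulRight (vertex k point)
  have hΦ (c : Fin 2 → k) :
      Φ c = c 0 • (vertex k source + vertex k target) + c 1 • vertex k point := rfl
  have hinj : Function.Injective Φ := by
    refine (injective_iff_map_eq_zero Φ).2 fun c hc => ?_
    have e : Φ c = ∑ v, (fun v => if v = point then c 1 else c 0) v • vertex k v +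
        (0 : k) • arrow k := by
      rw [hΦ, sum_univ]
      simp
      module
    ext i
    fin_cases i
    · have h := congrArg (coeff k ⟨source, source, .nil⟩) (e.symm.trans hc)
      rw [coeff_eq] at h
      simpa using h
    · have h := congrArg (coeff k ⟨point, point, .nil⟩) (e.symm.trans hc)
      rw [coeff_eq] at h
      simpa using h
  refine ⟨((LinearEquiv.ofInjective Φ hinj) ≪≫ₗ LinearEquiv.ofEq _
    (Subalgebra.toSubmodule (Subalgebra.center k (PathAlgebra k ArrowAndPoint))) ?_).symm⟩
  ext z
  rw [Subalgebra.mem_toSubmodule, mem_center_iff, LinearMap.mem_range]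
  constructor
  · rintro ⟨c, rfl⟩
    exact ⟨c 0, c 1, rfl⟩
  · rintro ⟨a, b, rfl⟩
    exact ⟨![a, b], by simp [hΦ]⟩

/-- A normalized cochain is determined by its value with the arrow in every argument. Balancing
forces this value to be zero in degree at least two, and a multiple of the arrow in degree one. -/
theorem subsingleton_HH {n : ℕ} (hn : 1 ≤ n) :
    Subsingleton (HH k (PathAlgebra k ArrowAndPoint) n) := by
  obtain ⟨n, rfl⟩ : ∃ m, n = m + 1 := ⟨n - 1, by omega⟩
  have h := completeOrthogonalIdempotents k (V := ArrowAndPoint)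
  let E := h.subalgebra k
  refine HH.subsingleton_of_exists fun f hf => ?_
  obtain ⟨g, hg⟩ := (h.separabilityData k).exists_vanishesAt f fun j _ s _ => by rw [hf]; rfl
  suffices hs : ∀ f' : HochschildCochain k _ (PathAlgebra k ArrowAndPoint) (n + 1),
      hochschildD k _ _ (n + 1) f' = 0 → (∀ j < n + 1, VanishesAt E j f') →
      f' ∈ hochschildCoboundaries k _ _ (n + 1) by
    have := hs (f - hochschildD k _ _ n g) (by
      rw [map_sub, hf, hochschildD_hochschildD, sub_zero]) hg
    have h' := Submodule.add_mem _ this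
      (show hochschildD k _ _ n g ∈ hochschildCoboundaries k _ _ (n + 1) from ⟨g, rfl⟩)
    rwa [sub_add_cancel] at h'
  clear hg g hf f
  intro f hd hf
  have hrel : IsRelative E f := isRelative_of_vanishesAt hf fun _ _ s _ => by rw [hd]; rfl
  have hext (f' : HochschildCochain k _ (PathAlgebra k ArrowAndPoint) (n + 1))
      (hf' : ∀ j < n + 1, VanishesAt E j f') (h : f' (fun _ => arrow k) = f fun _ => arrow k) :
      f' = f := by
    refine Module.Basis.ext_multilinear (fun _ => basis k) fun p => ?_
    by_cases hp : ∃ i v, p i = ⟨v, v, Quiver.Path.nil⟩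
    · obtain ⟨i, v, hi⟩ := hp
      obtain ⟨s, hs⟩ := exists_seq fun i => basis k (p i)
      have hsi : s i ∈ E := by
        have := congrFun hs i
        simp only [hi] at this
        rw [← this]
        exact CompleteOrthogonalIdempotents.self_mem k _ v
      rw [hs]
      exact (hf' i i.2 s hsi).trans (hf i i.2 s hsi).symm
    · have : (fun i => basis k (p i)) = fun _ => arrow k := by
        ext1 i
        rcases eq_nil_or_eq_arrowPath (p i) with ⟨v, hv⟩ | hv
        · exact (hp ⟨i, v, hv⟩).elim
        · rw [hv]; rfl
      rw [this, h]
  cases n with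
  | succ n =>
    have h0 : f (fun _ => arrow k) = 0 := by
      -- The source idempotent is absorbed by the first arrow on its right, but annihilates the
      -- second arrow from the left.
      have := hrel.seqEval_update (j := 0) (by omega)
        (CompleteOrthogonalIdempotents.self_mem k _ source) fun _ => arrow k
      rw [arrow_mul_vertex, if_pos rfl, Function.update_eq_self, vertex_mul_arrow,
        if_neg (by simp)] at this
      refine this.trans ?_
      exact f.map_coord_zero (1 : Fin (n + 2)) (by simp)
    exact hext 0 (fun _ _ _ _ => rfl) h0.symm ▸ Submodule.zero_mem _
  | zero =>
    have h1 : vertex k target * f (fun _ => arrow k) = f (fun _ => arrow k) := by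
      have := hrel.smul_seqEval (by omega)
        (CompleteOrthogonalIdempotents.self_mem k _ target) fun _ => arrow k
      rwa [vertex_mul_arrow, if_pos rfl, Function.update_eq_self] at this
    have h2 : f (fun _ => arrow k) * vertex k source = f (fun _ => arrow k) := by
      have := hrel.op_smul_seqEval
        (CompleteOrthogonalIdempotents.self_mem k _ source) fun _ => arrow k
      rwa [arrow_mul_vertex, if_pos rfl, Function.update_eq_self] at this
    -- The value lies between the target and the source idempotents, a Peirce component spanned by
    -- the arrow.
    obtain ⟨d, hd⟩ : ∃ d : k, f (fun _ => arrow k) = d • arrow k := by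
      rw [← h1, ← h2]
      obtain ⟨c, d, hcd⟩ := exists_eq k (f fun _ => arrow k)
      refine ⟨d, ?_⟩
      rw [hcd, mul_vertex_eq]
      simp only [mul_add, mul_smul_comm]
      simp [vertex_mul_arrow, (completeOrthogonalIdempotents k).ortho]
      exact Or.inr ((completeOrthogonalIdempotents k).ortho (by simp))
    -- The commutator of the arrow with the target vertex is minus the arrow, whence the factor
    -- `-d`.
    let g : HochschildCochain k _ (PathAlgebra k ArrowAndPoint) 0 :=
      MultilinearMap.constOfIsEmpty k (fun _ : Fin 0 => PathAlgebra k ArrowAndPoint)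
        (-d • vertex k target)
    have hg (a : Fin 1 → PathAlgebra k ArrowAndPoint) : hochschildD k _ _ 0 g a =
        -d • (a 0 * vertex k target - vertex k target * a 0) := by
      rw [hochschildD_apply]
      simp [g, sub_eq_add_neg]
    refine ⟨g, hext _ ?_ ?_⟩
    · rintro j hj s ⟨c, hc⟩
      obtain rfl : j = 0 := by omega
      refine (hg _).trans ?_
      change -d • (s 0 * _ - _ * s 0) = 0
      rw [← hc]
      simp only [h.sum_smul_mul, h.mul_sum_smul, sub_self, smul_zero]
    · refine (hg _).trans ?_
      rw [hd, arrow_mul_vertex, vertex_mul_arrow]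
      simp

end ArrowAndPoint

end PathAlgebra

/-! ### The alternating complex of a radical-square-zero algebra -/

section RoundTrip

namespace RoundTrip

/-- The other vertex. -/
def swap : RoundTrip → RoundTrip
  | e => f
  | f => e

theorem swap_swap (i : RoundTrip) : swap (swap i) = i := by cases i <;> rfl

theorem ne_swap (i : RoundTrip) : i ≠ swap i := by cases i <;> simp [swap]

theorem eq_swap_of_ne {i j : RoundTrip} (h : i ≠ j) : j = swap i := by
  cases i <;> cases j <;> simp_all [swap]

theorem sum_univ {N : Type*} [AddCommMonoid N] (g : RoundTrip → N) : ∑ v, g v = g e + g f := by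
  change ∑ v ∈ {e, f}, g v = _
  simp

theorem swap_iterate_of_even {n : ℕ} (h : Even n) (i : RoundTrip) : swap^[n] i = i := by
  rw [Function.Involutive.iterate_even swap_swap h, id]

theorem swap_iterate_of_odd {n : ℕ} (h : Odd n) (i : RoundTrip) : swap^[n] i = swap i := by
  rw [Function.Involutive.iterate_odd swap_swap h]

/-- A basis of matrix units of an algebra, in which the product of two off-diagonal elements is
zero. -/
structure RadSquareZeroBasis (k : Type u) [Field k] (A : Type v) [Ring A] [Algebra k A] where
  b : Module.Basis (RoundTrip × RoundTrip) k A
  mul_same : ∀ i j l, b (i, j) * b (j, l) = if i = j ∨ j = l then b (i, l) else 0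
  mul_ne : ∀ i j j' l, j ≠ j' → b (i, j) * b (j', l) = 0
  one : ∑ i, b (i, i) = 1

namespace RadSquareZeroBasis

variable {k : Type u} [Field k] {A : Type v} [Ring A] [Algebra k A] (R : RadSquareZeroBasis k A)

theorem idempotents : CompleteOrthogonalIdempotents fun i => R.b (i, i) where
  idem i := by
    rw [IsIdempotentElem, R.mul_same]
    simp
  ortho i j h := R.mul_ne _ _ _ _ h
  complete := R.one

/-- The span of the diagonal basis elements. -/
abbrev diag : Subalgebra k A := R.idempotents.subalgebra k

theorem self_mem_diag (i : RoundTrip) : R.b (i, i) ∈ R.diag := R.idempotents.self_mem k i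

/-- The off-diagonal part of an element. -/
def offDiag : A →ₗ[k] Matrix RoundTrip RoundTrip k where
  toFun a := Matrix.of fun i j => if i = j then 0 else R.b.repr a (i, j)
  map_add' a a' := by
    ext i j
    by_cases h : i = j <;> simp [h]
  map_smul' c a := by
    ext i j
    by_cases h : i = j <;> simp [h]

/-- The element with a given matrix of coordinates. -/
def ofMatrix : Matrix RoundTrip RoundTrip k →ₗ[k] A where
  toFun M := ∑ i, ∑ j, M i j • R.b (i, j)
  map_add' M N := by simp [add_smul, Finset.sum_add_distrib]
  map_smul' c M := by simp [Finset.smul_sum, smul_smul]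

theorem ofMatrix_apply (M : Matrix RoundTrip RoundTrip k) :
    R.ofMatrix M = ∑ i, ∑ j, M i j • R.b (i, j) := rfl

theorem offDiag_basis (i j : RoundTrip) :
    R.offDiag (R.b (i, j)) = if i = j then 0 else Matrix.single i j 1 := by
  ext i' j'
  simp only [offDiag, LinearMap.coe_mk, AddHom.coe_mk, Matrix.of_apply, Module.Basis.repr_self,
    Finsupp.single_apply, Prod.mk.injEq]
  split_ifs <;> simp [Matrix.single_apply] <;> grind

theorem ofMatrix_single (i j : RoundTrip) (c : k) :
    R.ofMatrix (Matrix.single i j c) = c • R.b (i, j) := by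
  rw [ofMatrix_apply, Finset.sum_eq_single i, Finset.sum_eq_single j]
  all_goals simp +contextual [Matrix.single_apply, eq_comm]

theorem diag_mul_basis (d : RoundTrip → k) (i j : RoundTrip) :
    (∑ i, d i • R.b (i, i)) * R.b (i, j) = d i • R.b (i, j) := by
  have h : R.b (i, j) = R.b (i, i) * R.b (i, j) := by simp [R.mul_same]
  rw [h, ← mul_assoc, R.idempotents.sum_smul_mul, smul_mul_assoc]

theorem basis_mul_diag (d : RoundTrip → k) (i j : RoundTrip) :
    R.b (i, j) * (∑ i, d i • R.b (i, i)) = d j • R.b (i, j) := by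
  have h : R.b (i, j) = R.b (i, j) * R.b (j, j) := by simp [R.mul_same]
  rw [h, mul_assoc, R.idempotents.mul_sum_smul, mul_smul_comm]

theorem repr_diag_mul (d : RoundTrip → k) (a : A) (i j : RoundTrip) :
    R.b.repr ((∑ i, d i • R.b (i, i)) * a) (i, j) = d i * R.b.repr a (i, j) := by
  have : (R.b.coord (i, j)) ∘ₗ LinearMap.mulLeft k (∑ i, d i • R.b (i, i)) =
      d i • R.b.coord (i, j) := by
    refine R.b.ext fun p => ?_
    obtain ⟨i', j'⟩ := p
    by_cases h : i' = i <;>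
      simp [diag_mul_basis, Finsupp.single_apply, h]
  exact LinearMap.congr_fun this a

theorem repr_mul_diag (d : RoundTrip → k) (a : A) (i j : RoundTrip) :
    R.b.repr (a * (∑ i, d i • R.b (i, i))) (i, j) = R.b.repr a (i, j) * d j := by
  have : (R.b.coord (i, j)) ∘ₗ LinearMap.mulRight k (∑ i, d i • R.b (i, i)) =
      d j • R.b.coord (i, j) := by
    refine R.b.ext fun p => ?_
    obtain ⟨i', j'⟩ := p
    by_cases h : j' = j <;> simp [basis_mul_diag, Finsupp.single_apply, h]
  rw [mul_comm]
  exact LinearMap.congr_fun this a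

theorem offDiag_diag_mul (d : RoundTrip → k) (a : A) :
    R.offDiag ((∑ i, d i • R.b (i, i)) * a) = Matrix.diagonal d * R.offDiag a := by
  ext i j
  rw [Matrix.diagonal_mul]
  simp only [offDiag, LinearMap.coe_mk, AddHom.coe_mk, Matrix.of_apply, repr_diag_mul]
  split_ifs <;> simp

theorem offDiag_mul_diag (d : RoundTrip → k) (a : A) :
    R.offDiag (a * (∑ i, d i • R.b (i, i))) = R.offDiag a * Matrix.diagonal d := by
  ext i j
  rw [Matrix.mul_diagonal]
  simp only [offDiag, LinearMap.coe_mk, AddHom.coe_mk, Matrix.of_apply, repr_mul_diag]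
  split_ifs <;> simp

theorem offDiag_eq_zero {a : A} (h : a ∈ R.diag) : R.offDiag a = 0 := by
  obtain ⟨d, rfl⟩ := h
  rw [map_sum]
  exact Finset.sum_eq_zero fun i _ => by rw [map_smul, offDiag_basis, if_pos rfl, smul_zero]

theorem diag_mul_ofMatrix (d : RoundTrip → k) (M : Matrix RoundTrip RoundTrip k) :
    (∑ i, d i • R.b (i, i)) * R.ofMatrix M = R.ofMatrix (Matrix.diagonal d * M) := by
  simp only [ofMatrix_apply, Matrix.diagonal_mul]
  simp only [Finset.mul_sum (s := Finset.univ) (a := ∑ i, d i • R.b (i, i)), mul_smul_comm,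
    diag_mul_basis, smul_smul, mul_comm]

theorem ofMatrix_mul_diag (d : RoundTrip → k) (M : Matrix RoundTrip RoundTrip k) :
    R.ofMatrix M * (∑ i, d i • R.b (i, i)) = R.ofMatrix (M * Matrix.diagonal d) := by
  simp only [ofMatrix_apply, Matrix.mul_diagonal]
  simp only [Finset.sum_mul _ _ (∑ i, d i • R.b (i, i)), smul_mul_assoc,
    basis_mul_diag, smul_smul]

/-- The Peirce components are lines, so a value confined to one of them is given by a scalar. -/
theorem basis_mul_mul (a : A) (i j : RoundTrip) :
    R.b (i, i) * a * R.b (j, j) = R.b.repr a (i, j) • R.b (i, j) := by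
  have (i : RoundTrip) : R.b (i, i) =
      ∑ l, (Pi.single i 1 : RoundTrip → k) l • R.b (l, l) := by
    simp [Pi.single_apply]
  refine R.b.repr.injective (Finsupp.ext fun ⟨i', j'⟩ => ?_)
  rw [this i, this j, repr_mul_diag, repr_diag_mul]
  simp only [Pi.single_apply, map_smul, Module.Basis.repr_self, Finsupp.smul_apply,
    Finsupp.single_apply, Prod.mk.injEq, smul_eq_mul]
  grind

/-- The ordered product of the first `n` entries of a sequence. -/
def seqProd {S : Type*} [Monoid S] (n : ℕ) (t : ℕ → S) : S := ((List.range n).map t).prod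

theorem seqProd_succ {S : Type*} [Monoid S] (n : ℕ) (t : ℕ → S) :
    seqProd (n + 1) t = seqProd n t * t n := List.prod_range_succ t n

theorem seqProd_succ' {S : Type*} [Monoid S] (n : ℕ) (t : ℕ → S) :
    seqProd (n + 1) t = t 0 * seqProd n fun l => t (l + 1) := List.prod_range_succ' t n

theorem seqProd_congr {S : Type*} [Monoid S] {n : ℕ} {t t' : ℕ → S} (h : ∀ l < n, t l = t' l) :
    seqProd n t = seqProd n t' := by
  rw [seqProd, List.map_congr_left fun l hl => h l (List.mem_range.1 hl)]
  rfl

theorem seqProd_eq_of_mul_eq {S : Type*} [Monoid S] {n j : ℕ} (hj : j + 1 < n) {t t' : ℕ → S}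
    (h : ∀ l, l ≠ j → l ≠ j + 1 → t l = t' l) (h' : t j * t (j + 1) = t' j * t' (j + 1)) :
    seqProd n t = seqProd n t' := by
  induction n with
  | zero => omega
  | succ n ih =>
    rw [seqProd_succ, seqProd_succ]
    rcases Nat.lt_succ_iff_lt_or_eq.1 hj with hj | rfl
    · rw [ih hj, h n (by omega) (by omega)]
    · rw [seqProd_succ, seqProd_succ, mul_assoc, h', ← mul_assoc,
        seqProd_congr fun l hl => h l (by omega) (by omega)]

theorem seqProd_eq_zero {S : Type*} [MonoidWithZero S] {n j : ℕ} (hj : j < n) {t : ℕ → S}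
    (h : t j = 0) : seqProd n t = 0 :=
  List.prod_eq_zero (List.mem_map.2 ⟨j, List.mem_range.2 hj, h⟩)

/-- The cochain whose value at the alternating sequence starting at `i` is `c i` times a basis
element. -/
def alternatingCochain (n : ℕ) (c : RoundTrip → k) : HochschildCochain k A A n :=
  (R.ofMatrix ∘ₗ LinearMap.mulLeft k (Matrix.diagonal c)).compMultilinearMap
    ((MultilinearMap.mkPiAlgebraFin k n (Matrix RoundTrip RoundTrip k)).compLinearMap
      fun _ => R.offDiag)

theorem seqEval_alternatingCochain (n : ℕ) (c : RoundTrip → k) (s : ℕ → A) :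
    seqEval (R.alternatingCochain n c) s =
      R.ofMatrix (Matrix.diagonal c * seqProd n fun l => R.offDiag (s l)) := by
  have : (List.ofFn fun l : Fin n => R.offDiag (s l)) =
      (List.range n).map fun l => R.offDiag (s l) := List.ext_getElem (by simp) (by simp)
  rw [seqProd, ← this]
  rfl

theorem alternatingCochain_smul (n : ℕ) (r : k) (c : RoundTrip → k) :
    R.alternatingCochain n (r • c) = r • R.alternatingCochain n c := by
  ext a
  obtain ⟨s, rfl⟩ := exists_seq a
  refine (R.seqEval_alternatingCochain n _ s).trans ?_
  rw [smul_apply]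
  change _ = r • seqEval _ s
  rw [seqEval_alternatingCochain, Matrix.diagonal_smul, Matrix.smul_mul, map_smul]

theorem alternatingCochain_add (n : ℕ) (c d : RoundTrip → k) :
    R.alternatingCochain n (c + d) = R.alternatingCochain n c + R.alternatingCochain n d := by
  ext a
  obtain ⟨s, rfl⟩ := exists_seq a
  refine (R.seqEval_alternatingCochain n _ s).trans ?_
  rw [add_apply]
  change _ = seqEval _ s + seqEval _ s
  rw [seqEval_alternatingCochain, seqEval_alternatingCochain, ← map_add, ← add_mul,
    Matrix.diagonal_add]
  rfl

theorem vanishesAt_alternatingCochain {n j : ℕ} (hj : j < n) (c : RoundTrip → k) :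
    VanishesAt R.diag j (R.alternatingCochain n c) := by
  intro s hs
  rw [seqEval_alternatingCochain, seqProd_eq_zero hj (R.offDiag_eq_zero hs), mul_zero, map_zero]

/-- `offDiag` and `ofMatrix` turn multiplication by diagonal elements into multiplication by
diagonal matrices, and balancing becomes associativity of the matrix product. That product is taken
in the full matrix algebra, where alternating strings do not vanish. -/
theorem isRelative_alternatingCochain (n : ℕ) (c : RoundTrip → k) :
    IsRelative R.diag (R.alternatingCochain n c) := by
  refine isRelative_of_seqEval ?_ ?_ ?_ ?_
  · rintro rfl _ ⟨d, rfl⟩ s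
    simp only [seqEval_alternatingCochain, smul_eq_mul, op_smul_eq_mul, diag_mul_ofMatrix,
      ofMatrix_mul_diag, seqProd, List.range_zero, List.map_nil, List.prod_nil, mul_one,
      Matrix.diagonal_mul_diagonal, mul_comm]
  · rintro hn _ ⟨d, rfl⟩ s
    obtain ⟨n, rfl⟩ : ∃ m, n = m + 1 := ⟨n - 1, by omega⟩
    simp only [seqEval_alternatingCochain, smul_eq_mul, diag_mul_ofMatrix, seqProd_succ',
      Function.update_self, offDiag_diag_mul]
    rw [← mul_assoc, ← mul_assoc, ← mul_assoc, ← mul_assoc, Matrix.diagonal_mul_diagonal,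
      Matrix.diagonal_mul_diagonal]
    simp [mul_comm]
  · rintro j hj _ ⟨d, rfl⟩ s
    rw [seqEval_alternatingCochain, seqEval_alternatingCochain, seqProd_eq_of_mul_eq hj]
    · intro l h1 h2
      rw [Function.update_of_ne h1, Function.update_of_ne h2]
    · simp [offDiag_diag_mul, offDiag_mul_diag, mul_assoc]
  · rintro n rfl _ ⟨d, rfl⟩ s
    simp only [seqEval_alternatingCochain, op_smul_eq_mul, ofMatrix_mul_diag, seqProd_succ,
      Function.update_self, offDiag_mul_diag, mul_assoc]
    have := seqProd_congr (n := n) (t := fun l => R.offDiag (s l))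
      (t' := fun l => R.offDiag (Function.update s n (s n * ∑ x, d x • R.b (x, x)) l))
      fun l hl => by rw [Function.update_of_ne (by omega)]
    rw [this]

/-- The alternating sequence of arrows starting at the row index `i`. -/
def altSeq (i : RoundTrip) (l : ℕ) : A := R.b (swap^[l] i, swap^[l + 1] i)

/-- The left factor selects the row `i`. In degree zero this is essential, because the empty product
is the identity matrix and involves both rows. -/
theorem basis_mul_alternatingCochain (n : ℕ) (c : RoundTrip → k) (i : RoundTrip) :
    R.b (i, i) * seqEval (R.alternatingCochain n c) (R.altSeq i) = c i • R.b (i, swap^[n] i) := by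
  have hi : R.b (i, i) = ∑ l, (Pi.single i 1 : RoundTrip → k) l • R.b (l, l) := by
    simp [Pi.single_apply]
  have hp : Matrix.single i i (1 : k) * seqProd n (fun l => R.offDiag (R.altSeq i l)) =
      Matrix.single i (swap^[n] i) 1 := by
    induction n with
    | zero => simp [seqProd]
    | succ n ih =>
      rw [seqProd_succ, ← mul_assoc, ih, altSeq, offDiag_basis, if_neg,
        Matrix.single_mul_single_same, mul_one]
      rw [Function.iterate_succ_apply']
      exact ne_swap _
  have hd : Matrix.diagonal (Pi.single i 1) * Matrix.diagonal c =
      c i • Matrix.single i i (1 : k) := by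
    ext a b
    simp only [Matrix.diagonal_mul, Matrix.diagonal_apply, Pi.single_apply, Matrix.smul_apply,
      Matrix.single_apply, smul_eq_mul]
    grind
  rw [seqEval_alternatingCochain, hi, diag_mul_ofMatrix, ← mul_assoc, hd, Matrix.smul_mul, hp,
    map_smul, ofMatrix_single, one_smul]

theorem alternatingCochain_injective (n : ℕ) : Function.Injective (R.alternatingCochain n) := by
  intro c d h
  ext i
  have h1 := R.basis_mul_alternatingCochain n c i
  rw [h, basis_mul_alternatingCochain] at h1
  exact (smul_left_injective k (R.b.ne_zero _) h1).symm

/-- A normalized relative cochain is determined by its values at alternating sequences. -/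
theorem cochain_ext {n : ℕ} {f g : HochschildCochain k A A n}
    (hf : ∀ j < n, VanishesAt R.diag j f) (hfr : IsRelative R.diag f)
    (hg : ∀ j < n, VanishesAt R.diag j g) (hgr : IsRelative R.diag g)
    (h : ∀ i, R.b (i, i) * seqEval f (R.altSeq i) = R.b (i, i) * seqEval g (R.altSeq i)) :
    f = g := by
  have one_mul_eq (x : A) : x = ∑ i, R.b (i, i) * x := by rw [← Finset.sum_mul, R.one, one_mul]
  refine Module.Basis.ext_multilinear (fun _ => R.b) fun p => ?_
  rcases Nat.eq_zero_or_pos n with rfl | hn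
  · have hs (i : RoundTrip) (f : HochschildCochain k A A 0) :
        f (fun l => R.b (p l)) = seqEval f (R.altSeq i) := congrArg f (Subsingleton.elim _ _)
    rw [one_mul_eq (f _), one_mul_eq (g _)]
    exact Finset.sum_congr rfl fun i _ => by rw [hs i, hs i, h]
  obtain ⟨q, rfl⟩ : ∃ q : ℕ → RoundTrip × RoundTrip, p = fun l : Fin n => q l :=
    ⟨fun l => if h : l < n then p ⟨l, h⟩ else (e, e), by simp⟩
  change seqEval f (fun l => R.b (q l)) = seqEval g (fun l => R.b (q l))
  by_cases hq : ∀ l < n, (q l).1 ≠ (q l).2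
  swap
  · push Not at hq
    obtain ⟨l, hl, h⟩ := hq
    have : R.b (q l) ∈ R.diag := by
      rw [← Prod.mk.eta (p := q l), h]
      exact R.self_mem_diag _
    rw [hf l hl _ this, hg l hl _ this]
  by_cases hc : ∀ l, l + 1 < n → (q l).2 = (q (l + 1)).1
  swap
  · push Not at hc
    obtain ⟨l, hl, h⟩ := hc
    -- At a break in the string, the idempotent at the end of one entry moves to the next entry and
    -- annihilates it.
    have key (f : HochschildCochain k A A n) (hfr : IsRelative R.diag f) :
        seqEval f (fun l => R.b (q l)) = 0 := by
      have := hfr.seqEval_update hl (R.self_mem_diag (q l).2) fun l => R.b (q l)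
      rw [show R.b (q l) * R.b ((q l).2, (q l).2) = R.b (q l) by
          simpa using R.mul_same (q l).1 (q l).2 (q l).2, Function.update_eq_self] at this
      rw [this]
      refine seqEval_eq_zero hl _ ?_
      rw [Function.update_self]
      exact R.mul_ne _ _ _ (q (l + 1)).2 h
    rw [key f hfr, key g hgr]
  have hs : ∀ l < n, q l = (swap^[l] (q 0).1, swap^[l + 1] (q 0).1) := by
    intro l hl
    induction l with
    | zero => exact Prod.ext rfl (eq_swap_of_ne (hq 0 hl))
    | succ l ih =>
      have h1 : (q (l + 1)).1 = swap^[l + 1] (q 0).1 := by rw [← hc l hl, ih (by omega)]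
      refine Prod.ext h1 ?_
      change _ = swap^[l + 1 + 1] (q 0).1
      rw [Function.iterate_succ_apply', ← h1]
      exact eq_swap_of_ne (hq _ hl)
  have key (f : HochschildCochain k A A n) (hfr : IsRelative R.diag f) :
      seqEval f (fun l => R.b (q l)) =
        R.b ((q 0).1, (q 0).1) * seqEval f (R.altSeq (q 0).1) := by
    rw [← smul_eq_mul, hfr.smul_seqEval hn (R.self_mem_diag _)]
    refine seqEval_congr _ fun l hl => ?_
    rcases Nat.eq_zero_or_pos l with rfl | h0
    · rw [hs 0 hl]
      simp [altSeq, R.mul_same]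
    · rw [Function.update_of_ne h0.ne', hs l hl, altSeq]
  rw [key f hfr, key g hgr, h]

/-- A normalized relative cochain is an alternating cochain. -/
theorem exists_eq_alternatingCochain {n : ℕ} {f : HochschildCochain k A A n}
    (hf : ∀ j < n, VanishesAt R.diag j f) (hfr : IsRelative R.diag f) :
    ∃ c, f = R.alternatingCochain n c := by
  refine ⟨fun i => R.b.repr (seqEval f (R.altSeq i)) (i, swap^[n] i), R.cochain_ext hf hfr
    (fun j hj => R.vanishesAt_alternatingCochain hj _) (R.isRelative_alternatingCochain _ _)
    fun i => ?_⟩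
  -- It remains to see that the value absorbs the idempotent at its right end: by commuting with
  -- idempotents in degree zero, by right linearity otherwise.
  rw [basis_mul_alternatingCochain, ← basis_mul_mul]
  cases n with
  | zero =>
    have := hfr.smul_eq_op_smul (R.self_mem_diag i) (R.altSeq i)
    rw [smul_eq_mul, op_smul_eq_mul] at this
    change _ = _ * _ * R.b (i, i)
    rw [mul_assoc, ← this, ← mul_assoc, R.idempotents.idem]
  | succ n =>
    have := hfr.op_smul_seqEval (R.self_mem_diag (swap^[n + 1] i)) (R.altSeq i)
    rw [altSeq, R.mul_same, if_pos (Or.inr rfl)] at this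
    rw [op_smul_eq_mul] at this
    rw [mul_assoc, this]
    exact congrArg _ (congrArg _ (Function.update_eq_self _ _).symm)

/-- The coboundary of an alternating cochain. -/
theorem seqEval_hochschildD_altSeq {n : ℕ} (f : HochschildCochain k A A n) (i : RoundTrip) :
    seqEval (hochschildD k A A n f) (R.altSeq i) =
      R.b (i, swap i) * seqEval f (R.altSeq (swap i)) +
        (-1 : k) ^ (n + 1) • (seqEval f (R.altSeq i) * R.b (swap^[n] i, swap^[n + 1] i)) := by
  rw [seqEval, hochschildD_apply, Finset.sum_eq_zero, add_zero]
  · rfl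
  · intro j _
    -- An inner face multiplies two consecutive arrows, and this product is zero.
    rw [f.map_coord_zero j, smul_zero]
    simp only [Fin.contractNth, Fin.val_castSucc, lt_irrefl, if_false, if_true, Fin.val_succ]
    rw [altSeq, altSeq, R.mul_same, if_neg]
    simp only [Function.iterate_succ_apply']
    exact not_or.2 ⟨ne_swap _, ne_swap _⟩

theorem hochschildD_alternatingCochain {n : ℕ} (c d : RoundTrip → k)
    (h : ∀ i, d i • R.b (i, swap^[n + 1] i) =
      c (swap i) • (R.b (i, swap i) * R.b (swap i, swap^[n + 1] i)) +
        (-1 : k) ^ (n + 1) • c i • (R.b (i, swap^[n] i) * R.b (swap^[n] i, swap^[n + 1] i))) :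
    hochschildD k A A n (R.alternatingCochain n c) = R.alternatingCochain (n + 1) d := by
  have hv : ∀ j < n + 1, VanishesAt R.diag j
      (hochschildD k A A n (R.alternatingCochain n c)) := fun j hj =>
    (R.isRelative_alternatingCochain n c).vanishesAt_hochschildD
      (fun j hj => R.vanishesAt_alternatingCochain hj c) (by omega)
  refine R.cochain_ext hv (isRelative_of_vanishesAt hv fun _ _ s _ => by
      rw [hochschildD_hochschildD]; rfl)
    (fun j hj => R.vanishesAt_alternatingCochain hj _) (R.isRelative_alternatingCochain _ _)
    fun i => ?_
  have h1 : R.b (i, i) * R.b (i, swap i) = R.b (i, swap i) * R.b (swap i, swap i) := by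
    simp [R.mul_same]
  rw [basis_mul_alternatingCochain, h, seqEval_hochschildD_altSeq, mul_add, ← mul_assoc, h1,
    mul_assoc, basis_mul_alternatingCochain, mul_smul_comm, mul_smul_comm, ← mul_assoc,
    basis_mul_alternatingCochain, smul_mul_assoc, ← Function.iterate_succ_apply]

/-- For even `n` an alternating string returns to its starting vertex, so the value there is a
vertex idempotent and both outer faces multiply it by an arrow. -/
theorem hochschildD_alternatingCochain_of_even {n : ℕ} (hn : Even n) (c : RoundTrip → k) :
    hochschildD k A A n (R.alternatingCochain n c) =
      R.alternatingCochain (n + 1) fun i => c (swap i) - c i := by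
  refine R.hochschildD_alternatingCochain _ _ fun i => ?_
  rw [swap_iterate_of_odd hn.add_one, swap_iterate_of_even hn, hn.add_one.neg_one_pow]
  simp [R.mul_same, add_smul, sub_eq_add_neg]

/-- For odd `n` the values are arrows, and both outer faces multiply two arrows. -/
theorem hochschildD_alternatingCochain_of_odd {n : ℕ} (hn : Odd n) (c : RoundTrip → k) :
    hochschildD k A A n (R.alternatingCochain n c) = 0 := by
  have h0 : R.alternatingCochain (n + 1) 0 = 0 := by
    simpa using R.alternatingCochain_smul (n + 1) 0 0
  rw [← h0]
  refine R.hochschildD_alternatingCochain _ _ fun i => ?_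
  rw [swap_iterate_of_even hn.add_one, swap_iterate_of_odd hn]
  simp [R.mul_same, ne_swap, (ne_swap _).symm]

/-- Applied to cocycles, this gives alternating representatives. The weaker hypothesis also covers a
cochain whose coboundary is alternating, which is what `exists_hochschildD_eq` needs. -/
theorem exists_sub_mem_coboundaries {n : ℕ} {f : HochschildCochain k A A n}
    (hdf : ∀ j ≤ n, VanishesAt R.diag j (hochschildD k A A n f)) :
    ∃ c, f - R.alternatingCochain n c ∈ hochschildCoboundaries k A A n := by
  cases n with
  | zero =>
    obtain ⟨c, hc⟩ := R.exists_eq_alternatingCochain (f := f) (by simp)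
      (isRelative_of_vanishesAt (by simp) hdf)
    exact ⟨c, by rw [hc, sub_self]; exact Submodule.zero_mem _⟩
  | succ n =>
    obtain ⟨g, hg⟩ := (R.idempotents.separabilityData k).exists_vanishesAt f
      fun j hj => hdf j hj.le
    obtain ⟨c, hc⟩ := R.exists_eq_alternatingCochain hg (isRelative_of_vanishesAt hg (by
      rw [map_sub, hochschildD_hochschildD, sub_zero]
      exact hdf))
    exact ⟨c, g, by rw [← hc, sub_sub_cancel]⟩

theorem hochschildD_eq_zero_of_mem {n : ℕ} {f : HochschildCochain k A A n}
    (hf : f ∈ hochschildCoboundaries k A A n) : hochschildD k A A n f = 0 := by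
  cases n with
  | zero => rw [(Submodule.mem_bot k).1 hf, map_zero]
  | succ n =>
    obtain ⟨g, rfl⟩ := hf
    exact hochschildD_hochschildD n g

/-- An alternating coboundary is the coboundary of an alternating cochain. -/
theorem exists_hochschildD_eq {n : ℕ} {c : RoundTrip → k}
    (h : R.alternatingCochain (n + 1) c ∈ hochschildCoboundaries k A A (n + 1)) :
    ∃ d, hochschildD k A A n (R.alternatingCochain n d) = R.alternatingCochain (n + 1) c := by
  obtain ⟨g, hg⟩ := h
  obtain ⟨d, hd⟩ := R.exists_sub_mem_coboundaries (f := g) (by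
    rw [hg]
    exact fun j hj => R.vanishesAt_alternatingCochain (by omega) c)
  refine ⟨d, ?_⟩
  have := hochschildD_eq_zero_of_mem hd
  rwa [map_sub, hg, sub_eq_zero, eq_comm] at this

theorem nonempty_HH_equiv (R : RadSquareZeroBasis k A) (n : ℕ) : Nonempty (HH k A n ≃ₗ[k] k) := by
  have h0 (n : ℕ) : R.alternatingCochain n 0 = 0 := by simpa using R.alternatingCochain_smul n 0 0
  have hco {n : ℕ} (f : HochschildCochain k A A n) (hf : hochschildD k A A n f = 0) :=
    R.exists_sub_mem_coboundaries (f := f) fun j _ s _ => by rw [hf]; rfl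
  rcases Nat.even_or_odd n with hn | hn
  · refine HH.nonempty_equiv_of_generator (R.alternatingCochain n 1) ?_ ?_ fun f hf => ?_
    · rw [R.hochschildD_alternatingCochain_of_even hn, ← h0]
      congr 1
      ext i
      simp
    · intro h
      -- The incoming differential is zero: it starts in odd degree, or `n = 0`.
      have h1 : R.alternatingCochain n 1 = R.alternatingCochain n 0 := by
        cases n with
        | zero => rw [h0]; exact (Submodule.mem_bot k).1 h
        | succ n =>
          obtain ⟨d, hd⟩ := R.exists_hochschildD_eq h
          rw [← hd, h0]
          exact R.hochschildD_alternatingCochain_of_odd (by simpa [parity_simps] using hn) d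
      simpa using congrFun (R.alternatingCochain_injective n h1) e
    · obtain ⟨c, hc⟩ := hco f hf
      have h1 := hochschildD_eq_zero_of_mem hc
      rw [map_sub, hf, R.hochschildD_alternatingCochain_of_even hn, zero_sub, neg_eq_zero,
        ← h0] at h1
      have h2 := congrFun (R.alternatingCochain_injective _ h1) e
      refine ⟨c e, ?_⟩
      have h3 : c e • (1 : RoundTrip → k) = c := by
        ext i
        cases i
        · simp
        · simpa [swap, sub_eq_zero, eq_comm] using h2
      rwa [← R.alternatingCochain_smul, h3]
  · obtain ⟨m, rfl⟩ : ∃ m, n = m + 1 := ⟨n - 1, by have := hn.pos; omega⟩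
    have hm : Even m := by simpa [parity_simps] using hn
    -- In odd degree the coboundaries are the `c` with `c e + c f = 0`, so this sum is the invariant
    -- of a class. The constant function `1` has sum `2` and would fail in characteristic two.
    refine HH.nonempty_equiv_of_generator (R.alternatingCochain (m + 1) (Pi.single e 1))
      (R.hochschildD_alternatingCochain_of_odd hn _) ?_ fun f hf => ?_
    · intro h
      obtain ⟨d, hd⟩ := R.exists_hochschildD_eq h
      rw [R.hochschildD_alternatingCochain_of_even hm] at hd
      have h1 := congrFun (R.alternatingCochain_injective _ hd)
      have h2 := h1 e
      have h3 := h1 f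
      simp only [swap, Pi.single_apply] at h2 h3
      simp at h2 h3
      rw [sub_eq_zero] at h3
      rw [h3] at h2
      simp at h2
    · obtain ⟨c, hc⟩ := hco f hf
      refine ⟨c e + c RoundTrip.f, ?_⟩
      have h1 : c = (c e + c RoundTrip.f) • (Pi.single e 1 : RoundTrip → k) +
          fun i => (Pi.single e (c RoundTrip.f) : RoundTrip → k) (swap i) -
            (Pi.single e (c RoundTrip.f) : RoundTrip → k) i := by
        ext i
        cases i <;> simp [swap, Pi.single_apply]
      rw [h1, R.alternatingCochain_add, ← R.hochschildD_alternatingCochain_of_even hm,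
        R.alternatingCochain_smul, ← sub_sub] at hc
      simpa using Submodule.add_mem _ hc
        (show hochschildD k A A m (R.alternatingCochain m (Pi.single e (c RoundTrip.f))) ∈
          hochschildCoboundaries k A A (m + 1) from ⟨_, rfl⟩)

end RadSquareZeroBasis

end RoundTrip

end RoundTrip

/-! ### A basis of the round-trip path algebra modulo paths of length two -/

section RoundTripAlgebra

namespace PathAlgebra

variable (k : Type u) [Field k] {V : Type v} [Quiver.{w} V] [DecidableEq V] [Fintype V]
variable {S : Type u} [CommRing S] [Algebra k S]

/-- The representation of a path algebra by matrices, in which every arrow is `t` times a matrix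
unit. -/
def toMatrix (t : S) : PathAlgebra k V →ₗ[k] Matrix V V S :=
  Finsupp.linearCombination k fun p : QuiverPath V => Matrix.single p.2.1 p.1 (t ^ p.2.2.length)

theorem toMatrix_of (t : S) (p : QuiverPath V) :
    toMatrix k t (of k p) = Matrix.single p.2.1 p.1 (t ^ p.2.2.length) := by
  unfold toMatrix of
  erw [Finsupp.linearCombination_single, one_smul]

/-- `toMatrix` as a homomorphism of algebras. -/
def toMatrixHom (t : S) : PathAlgebra k V →ₐ[k] Matrix V V S :=
  AlgHom.ofLinearMap (toMatrix k t)
    (by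
      change toMatrix k t (∑ v : V, vertex k v) = 1
      ext a b
      simp [vertex, toMatrix_of, Matrix.sum_apply, Matrix.single_apply, Matrix.one_apply, ite_and])
    (by
      intro x y
      induction x using PathAlgebra.induction with
      | h0 => simp
      | hadd x x' hx hx' => simp only [map_add, add_mul, hx, hx']
      | hof r p =>
        induction y using PathAlgebra.induction with
        | h0 => simp
        | hadd y y' hy hy' => simp only [map_add, mul_add, hy, hy']
        | hof r' q =>
          obtain ⟨a, b, p⟩ := p
          obtain ⟨c, d, q⟩ := q
          simp only [smul_mul_assoc, mul_smul_comm, map_smul, toMatrix_of, of_mul_of, pathMul]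
          by_cases h : d = a
          · subst h
            simp [toMatrix_of, pow_add, mul_comm]
          · simp [h, Matrix.single_mul_single_of_ne _ _ _ _ (Ne.symm h)])

theorem toMatrixHom_of (t : S) (p : QuiverPath V) :
    toMatrixHom k t (of k p) = Matrix.single p.2.1 p.1 (t ^ p.2.2.length) := toMatrix_of k t p

variable (V) in
-- The representation records the length of a path as the exponent of `t`, so `t ^ 2 = 0` kills the
-- generators of the ideal.
theorem idealGETwo_le_ker {t : S} (ht : t ^ 2 = 0) :
    (idealGETwo k V).ringCon ≤
      RingCon.ker (toMatrixHom k t : PathAlgebra k V →ₐ[k] Matrix V V S).toRingHom := by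
  have h : idealGETwo k V ≤ TwoSidedIdeal.ker (toMatrixHom k t : PathAlgebra k V →ₐ[k] _) := by
    refine TwoSidedIdeal.span_le.2 ?_
    rintro _ ⟨p, hp, rfl⟩
    refine (TwoSidedIdeal.mem_ker _).2 ?_
    rw [toMatrixHom_of, pow_eq_zero_of_le hp ht, Matrix.single_zero]
  intro x y hxy
  have := h ((TwoSidedIdeal.rel_iff _ x y).1 hxy)
  rw [TwoSidedIdeal.mem_ker, map_sub, sub_eq_zero] at this
  exact this

end PathAlgebra

namespace RoundTrip

open PathAlgebra

/-- The path of length at most one from `j` to `i`. -/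
def shortPath : RoundTrip → RoundTrip → QuiverPath RoundTrip
  | e, e => ⟨e, e, Quiver.Path.nil⟩
  | f, f => ⟨f, f, Quiver.Path.nil⟩
  | f, e => ⟨e, f, Quiver.Hom.toPath Arrow.x⟩
  | e, f => ⟨f, e, Quiver.Hom.toPath Arrow.y⟩

theorem shortPath_target (i j : RoundTrip) : (shortPath i j).2.1 = i := by
  cases i <;> cases j <;> rfl

theorem shortPath_source (i j : RoundTrip) : (shortPath i j).1 = j := by
  cases i <;> cases j <;> rfl

theorem shortPath_length (i j : RoundTrip) :
    (shortPath i j).2.2.length = if i = j then 0 else 1 := by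
  cases i <;> cases j <;> rfl

theorem exists_eq_shortPath {p : QuiverPath RoundTrip} (hp : p.2.2.length < 2) :
    ∃ i j, p = shortPath i j := by
  obtain ⟨a, b, p⟩ := p
  cases p with
  | nil => exact ⟨a, a, by cases a <;> rfl⟩
  | cons p h =>
    cases p with
    | nil =>
      change Arrow _ _ at h
      cases h
      · exact ⟨f, e, rfl⟩
      · exact ⟨e, f, rfl⟩
    | cons p h' =>
      simp only [Quiver.Path.length_cons] at hp
      omega

variable (k : Type u) [Field k]

theorem length_cast {V : Type v} [Quiver.{w} V] {a b c d : V} (h : a = c) (h' : b = d)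
    (p : Quiver.Path a b) : (p.cast h h').length = p.length := by
  subst h h'
  rfl

theorem of_shortPath_mul (i j l : RoundTrip) (h : i = j ∨ j = l) :
    of k (shortPath i j) * of k (shortPath j l) = of k (shortPath i l) := by
  have hv (i : RoundTrip) : of k (shortPath i i) = vertex k i := by cases i <;> rfl
  rcases h with rfl | rfl
  · rw [hv, vertex_mul_of, if_pos (shortPath_target _ _)]
  · rw [hv, of_mul_vertex, if_pos (shortPath_source _ _).symm]

/-- The class of a path modulo the paths of length at least two. -/
def pathClass (p : QuiverPath RoundTrip) : ModGETwo k RoundTrip :=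
  (idealGETwo k RoundTrip).ringCon.mkₐ (α := k) (of k p)

theorem pathClass_eq_zero {p : QuiverPath RoundTrip} (hp : 2 ≤ p.2.2.length) :
    pathClass k p = 0 :=
  ((idealGETwo k RoundTrip).ringCon.eq).2 (TwoSidedIdeal.subset_span ⟨p, hp, rfl⟩)

/-- The matrix representation over the dual numbers, with `t = ε`, factors through the quotient and
sends the classes of short paths to `1` or `ε` times distinct matrix units. -/
theorem linearIndependent_pathClass :
    LinearIndependent k fun q : RoundTrip × RoundTrip => pathClass k (shortPath q.1 q.2) := by
  let Φ : ModGETwo k RoundTrip →ₐ[k] Matrix RoundTrip RoundTrip (DualNumber k) :=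
    RingCon.liftₐ _ _ (idealGETwo_le_ker k RoundTrip (t := (DualNumber.eps : DualNumber k))
      (by rw [sq, DualNumber.eps_mul_eps]))
  have hΦ (i j : RoundTrip) : Φ (pathClass k (shortPath i j)) =
      Matrix.single i j (DualNumber.eps ^ if i = j then 0 else 1) := by
    refine (toMatrixHom_of k _ _).trans ?_
    rw [shortPath_length, shortPath_target, shortPath_source]
  refine Fintype.linearIndependent_iff.2 fun g hg ⟨i, j⟩ => ?_
  have h := congrFun (congrFun (congrArg Φ hg) i) j
  simp only [map_sum, map_smul, hΦ, map_zero, Matrix.sum_apply, Matrix.smul_apply] at h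
  rw [Finset.sum_eq_single (i, j)] at h
  -- Vertices are read off from the constant part of a dual number, arrows from its `ε` part.
  · by_cases hij : i = j
    · simpa [hij] using congrArg TrivSqZeroExt.fst h
    · simpa [hij] using congrArg TrivSqZeroExt.snd h
  · rintro ⟨i', j'⟩ _ hne
    rw [Matrix.single_apply_of_ne, smul_zero]
    exact fun h => hne (Prod.ext h.1 h.2)
  · simp

theorem span_pathClass :
    ⊤ ≤ Submodule.span k
      (Set.range fun q : RoundTrip × RoundTrip => pathClass k (shortPath q.1 q.2)) := by
  rintro x -
  obtain ⟨x, rfl⟩ := RingCon.mkₐ_surjective (α := k) _ x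
  induction x using PathAlgebra.induction with
  | h0 => rw [map_zero]; exact Submodule.zero_mem _
  | hadd x y hx hy => rw [map_add]; exact Submodule.add_mem _ hx hy
  | hof c p =>
    rw [map_smul]
    refine Submodule.smul_mem _ _ ?_
    change pathClass k p ∈ _
    rcases lt_or_ge p.2.2.length 2 with h | h
    · obtain ⟨i, j, rfl⟩ := exists_eq_shortPath h
      exact Submodule.subset_span ⟨(i, j), rfl⟩
    · rw [pathClass_eq_zero k h]
      exact Submodule.zero_mem _

/-- The classes of the paths of length at most one form a basis of matrix units. -/
def radSquareZeroBasis : RadSquareZeroBasis k (ModGETwo k RoundTrip) where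
  b := Module.Basis.mk (linearIndependent_pathClass k) (span_pathClass k)
  mul_same i j l := by
    simp only [Module.Basis.mk_apply, pathClass]
    rw [← map_mul]
    split_ifs with h
    · rw [of_shortPath_mul k i j l h]
    -- Both factors are arrows and they compose, giving a path of length two, which is zero in the
    -- quotient.
    · have hl : (shortPath j l).2.1 = (shortPath i j).1 :=
        (shortPath_target j l).trans (shortPath_source i j).symm
      rw [of_mul_of, pathMul, dif_pos hl]
      refine pathClass_eq_zero k ?_
      rw [not_or] at h
      rw [Quiver.Path.length_comp, shortPath_length, if_neg h.1, length_cast,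
        shortPath_length, if_neg h.2]
  mul_ne i j j' l h := by
    have hl : (shortPath j' l).2.1 ≠ (shortPath i j).1 := fun h' =>
      h ((shortPath_source i j).symm.trans (h'.symm.trans (shortPath_target j' l)))
    simp only [Module.Basis.mk_apply, pathClass]
    rw [← map_mul, of_mul_of, pathMul, dif_neg hl, map_zero]
  one := by
    simp only [Module.Basis.mk_apply]
    refine Eq.trans ?_ (map_one ((idealGETwo k RoundTrip).ringCon.mkₐ (α := k)))
    change _ = RingCon.mkₐ _ _ (∑ v, vertex k v)
    rw [map_sum]
    refine Finset.sum_congr rfl fun i _ => ?_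
    cases i <;> rfl

end RoundTrip

end RoundTripAlgebra

/-! ### Transport to isomorphic algebras and conclusion -/

section Conclusion

variable (k : Type u) [Field k]

/-- The Hochschild cohomology of the round-trip algebra with radical square zero. -/
theorem HH_roundTrip {A : Type v} [Ring A] [Algebra k A]
    (φ : A ≃ₐ[k] PathAlgebra.ModGETwo k RoundTrip) :
    (∀ n : ℕ, Nonempty (HH k A n ≃ₗ[k] k)) ∧ hochschildDim k A = ⊤ := by
  have h (n : ℕ) : Nonempty (HH k A n ≃ₗ[k] k) :=
    ((RoundTrip.radSquareZeroBasis k).nonempty_HH_equiv n).map fun ψ => HH.congr φ n ≪≫ₗ ψ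
  exact ⟨h, hochschildDim_eq_top fun n => (h n).some.toEquiv.nontrivial⟩

/-- Transport of vanishing higher cohomology along an isomorphism. -/
theorem HH_of_algEquiv {A : Type v} [Ring A] [Algebra k A] {B : Type w} [Ring B] [Algebra k B]
    (φ : A ≃ₐ[k] B) {N : Type*} [AddCommGroup N] [Module k N]
    (h : Nonempty (HH k B 0 ≃ₗ[k] N) ∧ ∀ n : ℕ, 1 ≤ n → Subsingleton (HH k B n)) :
    Nonempty (HH k A 0 ≃ₗ[k] N) ∧ ∀ n : ℕ, 1 ≤ n → Subsingleton (HH k A n) :=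
  ⟨h.1.map fun ψ => HH.congr φ 0 ≪≫ₗ ψ, fun n hn =>
    have := h.2 n hn
    (HH.congr φ n).toEquiv.subsingleton⟩

theorem HH_arrowAndPoint :
    Nonempty (HH k (PathAlgebra k ArrowAndPoint) 0 ≃ₗ[k] (Fin 2 → k)) ∧
      ∀ n : ℕ, 1 ≤ n → Subsingleton (HH k (PathAlgebra k ArrowAndPoint) n) :=
  ⟨(ArrowAndPoint.nonempty_center_equiv k).map fun ψ => HH.zeroEquiv k _ ≪≫ₗ ψ,
    fun _ hn => ArrowAndPoint.subsingleton_HH k hn⟩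

end Conclusion

end

theorem mainTheorem3 (k : Type u) [Field k] :
    -- the four algebras themselves
    ((Nonempty (HH k (Fin 4 → k) 0 ≃ₗ[k] (Fin 4 → k)) ∧
        ∀ n : ℕ, 1 ≤ n → Subsingleton (HH k (Fin 4 → k) n)) ∧
      (Nonempty (HH k (Matrix (Fin 2) (Fin 2) k) 0 ≃ₗ[k] k) ∧
        ∀ n : ℕ, 1 ≤ n → Subsingleton (HH k (Matrix (Fin 2) (Fin 2) k) n)) ∧
      ((∀ n : ℕ, Nonempty (HH k (PathAlgebra.ModGETwo k RoundTrip) n ≃ₗ[k] k)) ∧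
        hochschildDim k (PathAlgebra.ModGETwo k RoundTrip) = ⊤) ∧
      (Nonempty (HH k (PathAlgebra k ArrowAndPoint) 0 ≃ₗ[k] (Fin 2 → k)) ∧
        ∀ n : ℕ, 1 ≤ n → Subsingleton (HH k (PathAlgebra k ArrowAndPoint) n))) ∧
    -- every twisted tensor product of two copies of `k²` of one of these types
    ∀ (A : Type v) [Ring A] [Algebra k A] (B : Type w) [Ring B] [Algebra k B],
      Nonempty (A ≃ₐ[k] (Fin 2 → k)) → Nonempty (B ≃ₐ[k] (Fin 2 → k)) →
      ∀ τ : TwistingMap k A B,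
        (Nonempty (TwistedTensorProduct τ ≃ₐ[k] (Fin 4 → k)) →
          Nonempty (HH k (TwistedTensorProduct τ) 0 ≃ₗ[k] (Fin 4 → k)) ∧
          ∀ n : ℕ, 1 ≤ n → Subsingleton (HH k (TwistedTensorProduct τ) n)) ∧
        (Nonempty (TwistedTensorProduct τ ≃ₐ[k] Matrix (Fin 2) (Fin 2) k) →
          Nonempty (HH k (TwistedTensorProduct τ) 0 ≃ₗ[k] k) ∧
          ∀ n : ℕ, 1 ≤ n → Subsingleton (HH k (TwistedTensorProduct τ) n)) ∧
        (Nonempty (TwistedTensorProduct τ ≃ₐ[k] PathAlgebra.ModGETwo k RoundTrip) →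
          (∀ n : ℕ, Nonempty (HH k (TwistedTensorProduct τ) n ≃ₗ[k] k)) ∧
          hochschildDim k (TwistedTensorProduct τ) = ⊤) ∧
        (Nonempty (TwistedTensorProduct τ ≃ₐ[k] PathAlgebra k ArrowAndPoint) →
          Nonempty (HH k (TwistedTensorProduct τ) 0 ≃ₗ[k] (Fin 2 → k)) ∧
          ∀ n : ℕ, 1 ≤ n → Subsingleton (HH k (TwistedTensorProduct τ) n)) := by
  refine ⟨⟨HH_pi k (Fin 4), HH_matrix k (Fin 2), HH_roundTrip k AlgEquiv.refl,
    HH_arrowAndPoint k⟩, ?_⟩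
  intro A _ _ B _ _ _ _ τ
  exact ⟨fun ⟨φ⟩ => HH_of_algEquiv k φ (HH_pi k (Fin 4)),
    fun ⟨φ⟩ => HH_of_algEquiv k φ (HH_matrix k (Fin 2)),
    fun ⟨φ⟩ => HH_roundTrip k φ,
    fun ⟨φ⟩ => HH_of_algEquiv k φ (HH_arrowAndPoint k)⟩
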